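/- Let $d\ge 1$, $r\ge 0$ be integers, let $\Omega\subset\mathbb R^d$ be a bounded open set and let $\mathcal T_h=\{K_1,\dots,K_N\}$ be a partition of $\Omega$ into finitely many convex polytopes: the $K_j\subset\Omega$ are nonempty, bounded, open, pairwise disjoint, each a finite intersection of open half-spaces, and $\Omega\subset\bigcup_j\overline{K_j}$. Let $\mathcal E_h^I$ be the set of interior faces $e=\partial K_j\cap\partial K_k$ ($j<k$, only the part inside $\Omega$ and only those of positive $(d-1)$-dimensional measure being relevant), with unit normal $n_e$ pointing out of $K_j$, let $\mathcal E_h^B$ be the set of boundary faces (the parts on $\partial\Omega$ of the facets of the elements, each taken from its element, with $n_e$ the outer unit normal of that element), and $\mathcal E_h=\mathcal E_h^I\cup\mathcal E_h^B$; $n^{(i)}$ denotes the function equal to the $i$-th component of $n_e$ on $e$. Write $(v,w)_{\mathcal T_h}=\sum_j\int_{K_j}vw\,dx$ and, for a set $\mathcal S$ of faces, $\langle v,w\rangle_{\mathcal S}=\sum_{e\in\mathcal S}\int_e vw\,ds$. Let $$V_r^h=\prod_j\mathbb P_r(K_j),\qquad \mathcal V_h=\{v:\ v|_{K_j}\in W^{1,1}(K_j)\cap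 C^0(\overline{K_j})\ \text{for all } j\},$$ where $\mathbb P_r$ denotes the polynomials of total degree at most $r$. For $v\in\mathcal V_h$ and $e=\partial K_j\cap\partial K_k\in\mathcal E_h^I$, $j<k$, put $[v]=v|_{K_j}-v|_{K_k}$ (traces from inside the elements); put $\mathcal Q_i^-(v)=v|_{K_j}$, $\mathcal Q_i^+(v)=v|_{K_k}$ if $n_e^{(i)}<0$, and $\mathcal Q_i^-(v)=v|_{K_k}$, $\mathcal Q_i^+(v)=v|_{K_j}$ if $n_e^{(i)}\ge 0$. On a boundary face $[v]=\mathcal Q_i^\pm(v)=v$ is the trace of $v$ from its element. Let $\gamma_i^\pm$ be arbitrary real constants on each interior face. The discrete partial derivatives $\partial_{h,x_i}^\pm v\in V_r^h$ are defined by $$(\partial_{h,x_i}^\pm v,\varphi)_{\mathcal T_h}=\langle\mathcal Q_i^\pm(v)n^{(i)},[\varphi]\rangle_{\mathcal E_h}-(v,\partial_{x_i}\varphi)_{\mathcal T_h}+\langle\gamma_i^\pm[v],[\varphi]\rangle_{\mathcal E_h^I}\qquad\forall\varphi\in V_r^h,$$ and $\partial_{h,x_i}v=\frac12(\partial_{h,x_i}^-v+\partial_{h,x_i}^+v)$.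 For $f\in L^1(\Omega)$ the projection $\mathcal P_r^hf\in V_r^h$ is defined by $(\mathcal P_r^hf,\varphi)_{\mathcal T_h}=(f,\varphi)_{\mathcal T_h}$ for all $\varphi\in V_r^h$ (for $f\in L^2(\Omega)$ this is the $L^2$ projection). Let $F\in C^1(\mathbb R)$ with $F'$ bounded, and let $u,v\in\mathcal V_h\cap C^0(\Omega)$. Then $uv$ and $F(u)$ belong to $\mathcal V_h$, the functions $u\,\partial_{x_i}v+v\,\partial_{x_i}u$ and $F'(u)\,\partial_{x_i}u$ are integrable over $\bigcup_jK_j$ (with $\partial_{x_i}$ the elementwise weak derivative), the defining relations of $\partial^\pm_{h,x_i}(uv)$, $\partial^\pm_{h,x_i}F(u)$ and of the two projections below each have exactly one solution, and for $i=1,\dots,d$ $$\partial_{h,x_i}(uv)=\mathcal P_r^h\bigl(u\,\partial_{x_i}v+v\,\partial_{x_i}u\bigr),\qquad \partial_{h,x_i}F(u)=\mathcal P_r^h\bigl(F'(u)\,\partial_{x_i}u\bigr).$$ -/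

import Mathlib

open scoped MeasureTheory ContDiff
open MeasureTheory

noncomputable section

namespace DGCalculus

/-- Euclidean space `ℝ^d`. -/
abbrev E (d : ℕ) : Type := EuclideanSpace ℝ (Fin d)

/-- A bounded convex polytope with nonempty interior, given by finitely many half-spaces
`⟪n, x⟫ ≤ offset n` with unit outer normals `n`. -/
structure ConvexPolytope (d : ℕ) where
  normals : Finset (E d)
  offset : E d → ℝ
  norm_normal : ∀ n ∈ normals, ‖n‖ = 1
  nonempty : {x : E d | ∀ n ∈ normals, inner ℝ n x < offset n}.Nonempty
  bounded : Bornology.IsBounded {x : E d | ∀ n ∈ normals, inner ℝ n x < offset n}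

/-- The open polytope. -/
def ConvexPolytope.cell {d : ℕ} (P : ConvexPolytope d) : Set (E d) :=
  {x | ∀ n ∈ P.normals, inner ℝ n x < P.offset n}

/-- The part of the boundary of the polytope with outer unit normal `n`. -/
def ConvexPolytope.facet {d : ℕ} (P : ConvexPolytope d) (n : E d) : Set (E d) :=
  {x | x ∈ closure P.cell ∧ inner ℝ n x = P.offset n}

/-- A partition `𝒯_h` of `Ω` into finitely many convex polytopes, labelled by `Fin N`. No
matching condition is imposed on the faces of neighbouring elements. -/
structure Mesh (d : ℕ) (Ω : Set (E d)) where
  N : ℕ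
  elem : Fin N → ConvexPolytope d
  cell_subset : ∀ j, (elem j).cell ⊆ Ω
  cell_disjoint : ∀ j k, j ≠ k → Disjoint (elem j).cell (elem k).cell
  covers : Ω ⊆ ⋃ j, closure (elem j).cell

/-- The partial derivative `∂_{x_i} φ` of a differentiable function. -/
def partialDeriv {d : ℕ} (i : Fin d) (φ : E d → ℝ) (x : E d) : ℝ :=
  fderiv ℝ φ x (EuclideanSpace.single i 1)

/-- `g ∈ L¹(K)` is the weak derivative of `v` with respect to `x_i` on the open set `K`. -/
def IsWeakPartial {d : ℕ} (K : Set (E d)) (i : Fin d) (v g : E d → ℝ) : Prop :=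
  IntegrableOn g K volume ∧
    ∀ φ : E d → ℝ, ContDiff ℝ ∞ φ → HasCompactSupport φ → tsupport φ ⊆ K →
      ∫ x in K, v x * partialDeriv i φ x = - ∫ x in K, g x * φ x

/-- `v ∈ W^{1,1}(K)`. -/
def MemW11 {d : ℕ} (K : Set (E d)) (v : E d → ℝ) : Prop :=
  IntegrableOn v K volume ∧ ∀ i : Fin d, ∃ g : E d → ℝ, IsWeakPartial K i v g

/-- `v ∈ C⁰(K̄)`: the restriction of `v` to `K` extends continuously to the closure of `K`. -/
def MemC0Closure {d : ℕ} (K : Set (E d)) (v : E d → ℝ) : Prop :=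
  ∃ g : E d → ℝ, ContinuousOn g (closure K) ∧ Set.EqOn v g K

/-- The space `ℙ_r` of polynomials in `d` variables of (total) degree at most `r`. -/
abbrev Poly (d r : ℕ) : Type := MvPolynomial.restrictTotalDegree (Fin d) ℝ r

/-- The value of a polynomial at a point. -/
def Poly.val {d r : ℕ} (p : Poly d r) (x : E d) : ℝ :=
  MvPolynomial.eval (fun a => x a) (p : MvPolynomial (Fin d) ℝ)

/-- The value at a point of the partial derivative of a polynomial. -/
def Poly.partialVal {d r : ℕ} (i : Fin d) (p : Poly d r) (x : E d) : ℝ :=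
  MvPolynomial.eval (fun a => x a) (MvPolynomial.pderiv i (p : MvPolynomial (Fin d) ℝ))

/-- The two one-sided choices in the trace and derivative operators. -/
inductive Side where
  | minus : Side
  | plus : Side

namespace Mesh

variable {d : ℕ} {Ω : Set (E d)} (T : Mesh d Ω)

/-- The open element with label `j`. -/
def cell (j : Fin T.N) : Set (E d) := (T.elem j).cell

/-- Membership in `𝒱_h = W^{1,1}(𝒯_h) ∩ C⁰(𝒯_h)`. -/
def MemVh (v : E d → ℝ) : Prop :=
  ∀ j, MemW11 (T.cell j) v ∧ MemC0Closure (T.cell j) v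

/-- `g` is the (piecewise) weak derivative `∂_{x_i} v` of `v`. -/
def IsPartial (i : Fin d) (v g : E d → ℝ) : Prop :=
  ∀ j, IsWeakPartial (T.cell j) i v g

/-- The DG space `V_r^h = ∏_K ℙ_r(K)`. -/
abbrev DGSpace (r : ℕ) : Type := Fin T.N → Poly d r

/-- `(v, w)_{𝒯_h} = ∑_K ∫_K v w dx` for piecewise functions `v`, `w`. -/
def brokenInner (v w : Fin T.N → E d → ℝ) : ℝ :=
  ∑ j, ∫ x in T.cell j, v j x * w j x

/-- The trace of `v` from inside the element `j`: the limit of `v y` as `y → x`, `y ∈ K_j`. -/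
def trace (j : Fin T.N) (v : E d → ℝ) (x : E d) : ℝ :=
  extendFrom (T.cell j) v x

/-- The part inside `Ω` of the interior face `∂K_j ∩ ∂K_k`, where `n` is the outer unit normal of
`K_j`. For `j ≠ k` this set has positive `(d-1)`-dimensional measure for at most one normal `n`
of `K_j`, and the other sets contribute zero to all the integrals below. -/
def interiorFace (j k : Fin T.N) (n : E d) : Set (E d) :=
  (T.elem j).facet n ∩ closure (T.cell k) ∩ Ω

/-- The part on `∂Ω` of the facet of `K_j` with outer unit normal `n`. -/
def boundaryFace (j : Fin T.N) (n : E d) : Set (E d) :=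
  (T.elem j).facet n ∩ frontier Ω

/-- The sum over the interior faces `e = ∂K_j ∩ ∂K_k`, `j < k`, with normal `n_e = n_{K_j}`, of
the surface integrals of `f j k n_e`. -/
def interiorSum (f : Fin T.N → Fin T.N → E d → E d → ℝ) : ℝ :=
  ∑ j, ∑ k ∈ Finset.Ioi j, ∑ n ∈ (T.elem j).normals,
    ∫ x in T.interiorFace j k n, f j k n x ∂μHE[d - 1]

/-- The sum over the boundary faces, with outer unit normal `n_e`, of the surface integrals of
`f j n_e`, where `K_j` is the element containing the face. -/
def boundarySum (f : Fin T.N → E d → E d → ℝ) : ℝ :=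
  ∑ j, ∑ n ∈ (T.elem j).normals, ∫ x in T.boundaryFace j n, f j n x ∂μHE[d - 1]

/-- The jump `[v] = v|_{K_j} - v|_{K_k}` on an interior face. -/
def jump (j k : Fin T.N) (v : E d → ℝ) (x : E d) : ℝ := T.trace j v x - T.trace k v x

/-- The trace operators `𝒬_i^±` on the interior face between `K_j` and `K_k`, `j < k`. -/
def Q (s : Side) (i : Fin d) (j k : Fin T.N) (n : E d) (v : E d → ℝ) (x : E d) : ℝ :=
  match s with
  | Side.minus => if n i < 0 then T.trace j v x else T.trace k v x
  | Side.plus => if n i < 0 then T.trace k v x else T.trace j v x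

/-- Piecewise constant parameters `γ_i^±` on the interior faces: `γ s i j k` is the value of
`γ_i^s` on `∂K_j ∩ ∂K_k`, `j < k`. -/
abbrev Penalty : Type := Side → Fin d → Fin T.N → Fin T.N → ℝ

/-- `p ∈ V_r^h` satisfies the defining relation of `∂_{h,x_i}^± v`: for all `φ ∈ V_r^h`,
`(p, φ)_{𝒯_h} = ⟨𝒬_i^±(v) n^{(i)}, [φ]⟩_{ℰ_h} - (v, ∂_{x_i} φ)_{𝒯_h} + ⟨γ_i^± [v], [φ]⟩_{ℰ_h^I}`.
On a boundary face `𝒬_i^±(v)` is the trace of `v` and `[φ] = φ`. -/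
def IsDiscretePartialSided (r : ℕ) (γ : T.Penalty) (s : Side) (i : Fin d) (v : E d → ℝ)
    (p : T.DGSpace r) : Prop :=
  ∀ φ : T.DGSpace r,
    T.brokenInner (fun j => (p j).val) (fun j => (φ j).val) =
      (T.interiorSum (fun j k n x => T.Q s i j k n v x * n i * ((φ j).val x - (φ k).val x))
        + T.boundarySum (fun j n x => T.trace j v x * n i * (φ j).val x))
      - T.brokenInner (fun _ => v) (fun j => (φ j).partialVal i)
      + T.interiorSum (fun j k _ x =>
          γ s i j k * T.jump j k v x * ((φ j).val x - (φ k).val x))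

/-- The one-sided discrete partial derivative `∂_{h,x_i}^± v`. -/
def discretePartialSided (r : ℕ) (γ : T.Penalty) (s : Side) (i : Fin d) (v : E d → ℝ) :
    T.DGSpace r :=
  Classical.epsilon (T.IsDiscretePartialSided r γ s i v)

/-- The discrete partial derivative `∂_{h,x_i} v = (∂_{h,x_i}^- v + ∂_{h,x_i}^+ v) / 2`. -/
def discretePartial (r : ℕ) (γ : T.Penalty) (i : Fin d) (v : E d → ℝ) : T.DGSpace r :=
  (1 / 2 : ℝ) • (T.discretePartialSided r γ Side.minus i v
    + T.discretePartialSided r γ Side.plus i v)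

/-- `p ∈ V_r^h` satisfies the defining relation of the `L²` projection of `f`:
`(p, φ)_{𝒯_h} = (f, φ)_{𝒯_h}` for all `φ ∈ V_r^h`. -/
def IsL2Projection (r : ℕ) (f : E d → ℝ) (p : T.DGSpace r) : Prop :=
  ∀ φ : T.DGSpace r,
    T.brokenInner (fun j => (p j).val) (fun j => (φ j).val) =
      T.brokenInner (fun _ => f) (fun j => (φ j).val)

/-- The `L²` projection `𝒫_r^h f`. -/
def L2Projection (r : ℕ) (f : E d → ℝ) : T.DGSpace r :=
  Classical.epsilon (T.IsL2Projection r f)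

end Mesh

end DGCalculus

end

/-!
For a function `w` of the broken space that is continuous in `Ω`, the numerical traces `𝒬_i^±(w)`
are single-valued on interior faces and the jumps `[w]` vanish, so neither the side nor the penalty
matters. The elementwise divergence theorem then turns the defining relation of `∂_{h,x_i}^± w` into
`(∂_{h,x_i}^± w, φ) = (∂_{x_i} w, φ)`, which is the defining relation of the `L²` projection of the
weak derivative (`Mesh.isDiscretePartialSided_iff_isL2Projection`). With `w = u v` and `w = F(u)`
the theorem reduces to the weak product and chain rules on each element and to the unique
solvability of the `L²` projection.

* Product and chain rule. For a test function `φ`, mollifications of `v φ` are admissible test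
  functions for `u`; passing to the limit gives the product rule (`IsWeakPartial.mul`). The product
  rule yields the chain rule for polynomials, and Weierstrass approximation of `F'` on the bounded
  range of `u` yields it for `F` of class `C¹` (`IsWeakPartial.comp`).

* Divergence theorem. On a polytope the weak derivative is tested with `φ` times a product of
  one-dimensional cutoffs of the distances to the bounding hyperplanes. Fubini's theorem in the
  direction of a normal, in isometric coordinates in which the surface measure is Lebesgue measure
  (`map_volume_hyperplane`), shows that the derivative of the cutoff concentrates on the facet with
  that normal (`ConvexPolytope.tendsto_layer`). In the limit this is the divergence theorem
  (`ConvexPolytope.integral_weakPartial_mul`), with no regularity theory for traces, since the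
  functions are continuous up to the boundary.

* Faces. Non-parallel hyperplanes meet in sets of zero surface measure, so almost every point of a
  facet inside `Ω` lies on no bounding hyperplane of the mesh other than that of the facet. Near such
  a point every element whose closure contains it is a half ball; hence the point belongs to the
  closure of exactly one other element, which has the opposite normal
  (`Mesh.setIntegral_facet_inter`, `Mesh.sum_interiorFace_swap`). This holds without any matching
  condition on the faces.
-/

namespace DGCalculus

open Filter Topology

variable {d : ℕ}

/-! ### Mollification -/

section Mollification

open ContinuousLinearMap (lsmul lsmul_apply)
open scoped Convolution

lemma partialDeriv_mul {i : Fin d} {φ ψ : E d → ℝ} {x : E d} (hφ : DifferentiableAt ℝ φ x)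
    (hψ : DifferentiableAt ℝ ψ x) :
    partialDeriv i (fun y => φ y * ψ y) x
      = φ x * partialDeriv i ψ x + ψ x * partialDeriv i φ x := by
  simp [partialDeriv, fderiv_fun_mul hφ hψ]

lemma continuous_partialDeriv {i : Fin d} {φ : E d → ℝ} (hφ : ContDiff ℝ ∞ φ) :
    Continuous (partialDeriv i φ) :=
  (hφ.continuous_fderiv (by simp)).clm_apply continuous_const

lemma partialDeriv_eq_zero_of_notMem_tsupport {i : Fin d} {φ : E d → ℝ} {x : E d}
    (hx : x ∉ tsupport φ) : partialDeriv i φ x = 0 := by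
  have : fderiv ℝ φ x = 0 := by
    by_contra h
    exact hx (support_fderiv_subset ℝ h)
  simp [partialDeriv, this]

lemma hasCompactSupport_partialDeriv {i : Fin d} {φ : E d → ℝ} (hφ : HasCompactSupport φ) :
    HasCompactSupport (partialDeriv i φ) :=
  hφ.mono' fun t ht => by
    by_contra hn
    exact ht (partialDeriv_eq_zero_of_notMem_tsupport hn)

lemma partialDeriv_convolution {i : Fin d} {f R : E d → ℝ} (hf : LocallyIntegrable f volume)
    (hR : ContDiff ℝ ∞ R) (hRc : HasCompactSupport R) (x : E d) :
    partialDeriv i (f ⋆[lsmul ℝ ℝ, volume] R) x = ∫ t, f t * partialDeriv i R (x - t) := by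
  have hR1 : ContDiff ℝ 1 R := hR.of_le (by simp)
  have h := hRc.hasFDerivAt_convolution_right (lsmul ℝ ℝ) hf hR1 x
  rw [partialDeriv, h.fderiv, convolution_precompR_apply (lsmul ℝ ℝ) hf (hRc.fderiv ℝ)
    (hR1.continuous_fderiv one_ne_zero)]
  rfl

lemma partialDeriv_comp_sub_left {i : Fin d} {R : E d → ℝ} (hR : Differentiable ℝ R) (x t : E d) :
    partialDeriv i (fun y => R (x - y)) t = - partialDeriv i R (x - t) := by
  have h1 : HasFDerivAt (fun y : E d => x - y) (-(ContinuousLinearMap.id ℝ (E d))) t :=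
    (hasFDerivAt_id t).const_sub x
  have h := (hR (x - t)).hasFDerivAt.comp t h1
  have h2 : fderiv ℝ (fun y => R (x - y)) t
      = (fderiv ℝ R (x - t)).comp (-(ContinuousLinearMap.id ℝ (E d))) := h.fderiv
  simp [partialDeriv, h2]

/-- Bump functions with supports shrinking to the origin. -/
noncomputable def bump (d n : ℕ) : ContDiffBump (0 : E d) where
  rIn := 1 / (2 * (n + 1))
  rOut := 1 / (n + 1)
  rIn_pos := by positivity
  rIn_lt_rOut := by
    apply one_div_lt_one_div_of_lt <;> linarith [(Nat.cast_nonneg n : (0 : ℝ) ≤ n)]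

lemma tendsto_bump_rOut : Tendsto (fun n => (bump d n).rOut) atTop (𝓝 0) :=
  tendsto_one_div_add_atTop_nhds_zero_nat

/-- A bump function of integral one, supported in the ball of radius `1 / (n + 1)`. -/
noncomputable def mollifier (d n : ℕ) : E d → ℝ := (bump d n).normed volume

lemma contDiff_mollifier (n : ℕ) : ContDiff ℝ ∞ (mollifier d n) := (bump d n).contDiff_normed

lemma hasCompactSupport_mollifier (n : ℕ) : HasCompactSupport (mollifier d n) :=
  (bump d n).hasCompactSupport_normed

lemma mollifier_sub_comm (n : ℕ) (x y : E d) : mollifier d n (x - y) = mollifier d n (y - x) := by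
  rw [mollifier, ← (bump d n).normed_neg, neg_sub]

lemma convolution_mollifier_eq (f : E d → ℝ) (n : ℕ) (x : E d) :
    (f ⋆[lsmul ℝ ℝ, volume] mollifier d n) x = ∫ t, f t * mollifier d n (x - t) := rfl

lemma convolution_mollifier_comm (f : E d → ℝ) (n : ℕ) :
    f ⋆[lsmul ℝ ℝ, volume] mollifier d n = mollifier d n ⋆[lsmul ℝ ℝ, volume] f := by
  ext x
  rw [convolution_lsmul_swap]
  simp [convolution_def, mul_comm]

lemma continuous_convolution_mollifier {f : E d → ℝ} (hf : LocallyIntegrable f volume) (n : ℕ) :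
    Continuous (f ⋆[lsmul ℝ ℝ, volume] mollifier d n) :=
  ((hasCompactSupport_mollifier n).contDiff_convolution_right (lsmul ℝ ℝ) hf
    (contDiff_mollifier n)).continuous

lemma tendsto_convolution_mollifier {f : E d → ℝ} (hf : AEStronglyMeasurable f volume) {x : E d}
    (hx : ContinuousAt f x) :
    Tendsto (fun n => (f ⋆[lsmul ℝ ℝ, volume] mollifier d n) x) atTop (𝓝 (f x)) := by
  simp_rw [convolution_mollifier_comm]
  exact ContDiffBump.convolution_tendsto_right (g := fun _ => f) (k := fun _ => x)
    (φ := bump d) tendsto_bump_rOut (Eventually.of_forall fun _ => hf)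
    (hx.tendsto.comp tendsto_snd) tendsto_const_nhds

lemma abs_convolution_mollifier_le {f : E d → ℝ} {C : ℝ} (hf : ∀ x, |f x| ≤ C) (n : ℕ) (x : E d) :
    |(f ⋆[lsmul ℝ ℝ, volume] mollifier d n) x| ≤ C := by
  rw [convolution_mollifier_comm, convolution_def]
  calc |∫ t, (lsmul ℝ ℝ (mollifier d n t)) (f (x - t))|
      ≤ ∫ t, mollifier d n t * C := by
        rw [← Real.norm_eq_abs]
        refine norm_integral_le_of_norm_le ((bump d n).integrable_normed.mul_const C) ?_
        refine Eventually.of_forall fun t => ?_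
        have h0 : 0 ≤ mollifier d n t := (bump d n).nonneg_normed t
        simp only [lsmul_apply, smul_eq_mul, norm_mul, Real.norm_eq_abs, abs_of_nonneg h0]
        exact mul_le_mul_of_nonneg_left (hf _) h0
    _ = C := by
        rw [integral_mul_const, mollifier, (bump d n).integral_normed, one_mul]

/-- Mollification is self-adjoint. -/
lemma integral_mul_convolution_mollifier_comm {f g : E d → ℝ} (hf : Integrable f volume)
    (hg : Integrable g volume) (n : ℕ) :
    ∫ x, f x * (g ⋆[lsmul ℝ ℝ, volume] mollifier d n) x
      = ∫ x, (f ⋆[lsmul ℝ ℝ, volume] mollifier d n) x * g x := by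
  simp_rw [convolution_mollifier_eq, ← integral_const_mul, ← integral_mul_const]
  rw [integral_integral_swap]
  · refine integral_congr_ae (Eventually.of_forall fun x => integral_congr_ae
      (Eventually.of_forall fun y => ?_))
    simp only
    rw [mollifier_sub_comm]
    ring
  · obtain ⟨C, hC⟩ := (hasCompactSupport_mollifier n).exists_bound_of_continuous
      (contDiff_mollifier (d := d) n).continuous
    have h1 : Integrable (fun p : E d × E d => f p.1 * g p.2) (volume.prod volume) :=
      hf.mul_prod hg
    have h2 := h1.bdd_mul (c := C) (f := fun p : E d × E d => mollifier d n (p.1 - p.2))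
      (((contDiff_mollifier n).continuous.comp
        (continuous_fst.sub continuous_snd)).aestronglyMeasurable)
      (Eventually.of_forall fun p => hC _)
    refine h2.congr (Eventually.of_forall fun p => ?_)
    simp only [Function.uncurry]
    ring

/-- The support of a mollification stays inside an open set containing the support of the
function, once the mollifier is concentrated enough. -/
lemma eventually_tsupport_convolution_mollifier_subset {K : Set (E d)} (hK : IsOpen K)
    {f : E d → ℝ} (hf : HasCompactSupport f) (hfK : tsupport f ⊆ K) :
    ∀ᶠ n in atTop, HasCompactSupport (f ⋆[lsmul ℝ ℝ, volume] mollifier d n) ∧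
      tsupport (f ⋆[lsmul ℝ ℝ, volume] mollifier d n) ⊆ K := by
  obtain ⟨δ, hδ, hδK⟩ := hf.isCompact.exists_cthickening_subset_open hK hfK
  filter_upwards [tendsto_bump_rOut (d := d) (Iio_mem_nhds hδ)] with n hn
  have hn : (bump d n).rOut < δ := hn
  have hsub : tsupport (f ⋆[lsmul ℝ ℝ, volume] mollifier d n)
      ⊆ Metric.cthickening δ (tsupport f) := by
    refine closure_minimal ?_ Metric.isClosed_cthickening
    refine (support_convolution_subset _).trans ?_
    rintro _ ⟨a, ha, b, hb, rfl⟩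
    have hb' : b ∈ Metric.ball (0 : E d) (bump d n).rOut := by
      rw [← (bump d n).support_normed_eq (μ := volume)]
      exact hb
    refine Metric.mem_cthickening_of_dist_le _ a _ _ (subset_tsupport f ha) ?_
    simp only [mem_ball_zero_iff] at hb'
    simp only [dist_self_add_left]
    linarith
  refine ⟨?_, hsub.trans hδK⟩
  exact hf.isCompact.cthickening.of_isClosed_subset (isClosed_tsupport _) hsub

/-! ### The weak product rule -/

lemma integrableOn_of_continuousOn_of_bounded {K : Set (E d)} (hK : MeasurableSet K)
    (hKb : Bornology.IsBounded K) {u : E d → ℝ} (hu : ContinuousOn u K) {C : ℝ}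
    (hC : ∀ x ∈ K, |u x| ≤ C) : IntegrableOn u K volume :=
  IntegrableOn.of_bound hKb.measure_lt_top (hu.aestronglyMeasurable hK) C
    ((ae_restrict_iff' hK).2 (Eventually.of_forall hC))

lemma integrableOn_mul_of_continuousOn {K : Set (E d)} (hK : MeasurableSet K)
    {u g : E d → ℝ} (hu : ContinuousOn u K) {C : ℝ}
    (hC : ∀ x ∈ K, |u x| ≤ C) (hg : IntegrableOn g K volume) :
    IntegrableOn (fun x => u x * g x) K volume :=
  Integrable.bdd_mul hg (hu.aestronglyMeasurable hK)
    ((ae_restrict_iff' hK).2 (Eventually.of_forall hC))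

/-- The product `v φ` with a test function `φ` has, as a function on the whole space, the weak
derivative `v ∂φ + ∂v φ`. Hence the smooth `R` needs no compact support in `K`: the product
`φ R(x - ·)` is a test function on `K`. -/
lemma IsWeakPartial.integral_mul_test {K : Set (E d)} (hK : IsOpen K)
    (hKb : Bornology.IsBounded K) {i : Fin d} {v dv : E d → ℝ} (hv : ContinuousOn v K) {C : ℝ}
    (hC : ∀ x ∈ K, |v x| ≤ C) (h : IsWeakPartial K i v dv) {φ R : E d → ℝ}
    (hφ : ContDiff ℝ ∞ φ) (hφc : HasCompactSupport φ) (hφK : tsupport φ ⊆ K)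
    (hR : ContDiff ℝ ∞ R) (x : E d) :
    ∫ t in K, v t * φ t * partialDeriv i R (x - t)
      = ∫ t in K, (v t * partialDeriv i φ t + dv t * φ t) * R (x - t) := by
  have hRx : ContDiff ℝ ∞ (fun y => R (x - y)) := hR.comp (contDiff_const.sub contDiff_id)
  have hd := hφ.differentiable (by simp)
  have hRd := hR.differentiable (by simp)
  have hvi := integrableOn_of_continuousOn_of_bounded hK.measurableSet hKb hv hC
  have htest := h.2 (fun y => φ y * R (x - y)) (hφ.mul hRx) hφc.mul_right
    ((tsupport_mul_subset_left).trans hφK)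
  have hpd : ∀ t, partialDeriv i (fun y => φ y * R (x - y)) t
      = R (x - t) * partialDeriv i φ t - φ t * partialDeriv i R (x - t) := fun t => by
    rw [partialDeriv_mul (hd t) (hRx.differentiable (by simp) t), partialDeriv_comp_sub_left hRd]
    ring
  simp_rw [hpd] at htest
  have cφ := hφ.continuous
  have cRx := hRx.continuous
  have cdφ := continuous_partialDeriv (i := i) hφ
  have cdR : Continuous fun t => partialDeriv i R (x - t) :=
    (continuous_partialDeriv (i := i) hR).comp (continuous_const.sub continuous_id)
  -- a continuous function with compact support is bounded, so it preserves integrability on `K`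
  have key : ∀ (w ψ : E d → ℝ), IntegrableOn w K volume → Continuous ψ → HasCompactSupport ψ →
      IntegrableOn (fun t => w t * ψ t) K volume := fun w ψ hw hψ hψc => by
    obtain ⟨B, hB⟩ := hψc.exists_bound_of_continuous hψ
    exact Integrable.mul_bdd hw hψ.aestronglyMeasurable (Eventually.of_forall hB)
  have cs : HasCompactSupport (partialDeriv i φ) := hasCompactSupport_partialDeriv hφc
  have i1 := key v (fun t => φ t * partialDeriv i R (x - t)) hvi (cφ.mul cdR) hφc.mul_right
  have i2 := key v (fun t => partialDeriv i φ t * R (x - t)) hvi (cdφ.mul cRx) cs.mul_right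
  have i3 := key dv (fun t => φ t * R (x - t)) h.1 (cφ.mul cRx) hφc.mul_right
  have e1 : ∫ t in K, v t * (R (x - t) * partialDeriv i φ t - φ t * partialDeriv i R (x - t))
      = (∫ t in K, v t * (partialDeriv i φ t * R (x - t)))
        - ∫ t in K, v t * (φ t * partialDeriv i R (x - t)) := by
    rw [← integral_sub i2 i1]
    congr 1; ext t; ring
  have e2 : ∫ t in K, (v t * partialDeriv i φ t + dv t * φ t) * R (x - t)
      = (∫ t in K, v t * (partialDeriv i φ t * R (x - t)))
        + ∫ t in K, dv t * (φ t * R (x - t)) := by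
    rw [← integral_add i2 i3]
    congr 1; ext t; ring
  rw [e1] at htest
  rw [e2]
  have e3 : ∫ t in K, v t * φ t * partialDeriv i R (x - t)
      = ∫ t in K, v t * (φ t * partialDeriv i R (x - t)) := by
    congr 1; ext t; ring
  linarith

/-- Weak product rule for bounded continuous functions. With `ψ = v φ` for a test function `φ`, the
mollifications of `ψ` are admissible test functions for `u`, and letting the mollification parameter
tend to zero gives the formula. -/
theorem IsWeakPartial.mul {K : Set (E d)} (hK : IsOpen K)
    (hKb : Bornology.IsBounded K) {i : Fin d} {u v du dv : E d → ℝ}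
    (hu : ContinuousOn u K) {Cu : ℝ} (hCu : ∀ x ∈ K, |u x| ≤ Cu)
    (hv : ContinuousOn v K) {Cv : ℝ} (hCv : ∀ x ∈ K, |v x| ≤ Cv)
    (hdu : IsWeakPartial K i u du) (hdv : IsWeakPartial K i v dv) :
    IsWeakPartial K i (fun x => u x * v x) (fun x => u x * dv x + v x * du x) := by
  have mK := hK.measurableSet
  have j1 := integrableOn_mul_of_continuousOn mK hu hCu hdv.1
  have j2 := integrableOn_mul_of_continuousOn mK hv hCv hdu.1
  refine ⟨j1.add j2, fun φ hφ hφc hφK => ?_⟩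
  have cφ := hφ.continuous
  have cdφ := continuous_partialDeriv (i := i) hφ
  have cs : HasCompactSupport (partialDeriv i φ) := hasCompactSupport_partialDeriv hφc
  obtain ⟨A, hA⟩ := hφc.exists_bound_of_continuous cφ
  obtain ⟨B, hB⟩ := cs.exists_bound_of_continuous cdφ
  have hui := integrableOn_of_continuousOn_of_bounded mK hKb hu hCu
  have hvi := integrableOn_of_continuousOn_of_bounded mK hKb hv hCv
  have i1 : IntegrableOn (fun t => v t * φ t) K volume :=
    Integrable.mul_bdd hvi cφ.aestronglyMeasurable (Eventually.of_forall hA)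
  have i2 : IntegrableOn (fun t => v t * partialDeriv i φ t) K volume :=
    Integrable.mul_bdd hvi cdφ.aestronglyMeasurable (Eventually.of_forall hB)
  have i3 : IntegrableOn (fun t => dv t * φ t) K volume :=
    Integrable.mul_bdd hdv.1 cφ.aestronglyMeasurable (Eventually.of_forall hA)
  set ψ : E d → ℝ := fun t => v t * φ t with hψ
  set h : E d → ℝ := fun t => v t * partialDeriv i φ t + dv t * φ t with hh
  have ih : IntegrableOn h K volume := i2.add i3
  have hφ0 : ∀ t, t ∉ K → φ t = 0 := fun t ht => image_eq_zero_of_notMem_tsupport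
    fun h' => ht (hφK h')
  have hψind : K.indicator ψ = ψ := by
    ext t
    by_cases ht : t ∈ K
    · simp [ht]
    · simp [ht, hψ, hφ0 t ht]
  have iψ : Integrable ψ volume := by
    rw [← hψind]; exact (integrable_indicator_iff mK).2 i1
  have iU : Integrable (K.indicator u) volume := (integrable_indicator_iff mK).2 hui
  have iH : Integrable (K.indicator h) volume := (integrable_indicator_iff mK).2 ih
  have hψc : HasCompactSupport ψ := hφc.mul_left
  have hψK : tsupport ψ ⊆ K := (tsupport_mul_subset_right).trans hφK
  have hψb : ∀ t, |ψ t| ≤ |Cv| * |A| := fun t => by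
    by_cases ht : t ∈ K
    · rw [hψ]
      simp only [abs_mul]
      exact mul_le_mul ((hCv t ht).trans (le_abs_self _)) ((hA t).trans (le_abs_self _))
        (abs_nonneg _) (abs_nonneg _)
    · simp only [hψ, hφ0 t ht, mul_zero, abs_zero]; positivity
  have hUb : ∀ t, |K.indicator u t| ≤ |Cu| := fun t => by
    by_cases ht : t ∈ K
    · simpa [ht] using (hCu t ht).trans (le_abs_self _)
    · simp [ht]
  -- `u` tested with the mollification of `ψ`, whose derivative is the mollification of `h`;
  -- self-adjointness then moves the mollifier onto `u`, which is bounded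
  have hid : ∀ᶠ n in atTop,
      ∫ x in K, (K.indicator u ⋆[lsmul ℝ ℝ, volume] mollifier d n) x * h x
        = - ∫ x in K, du x * (ψ ⋆[lsmul ℝ ℝ, volume] mollifier d n) x := by
    filter_upwards [eventually_tsupport_convolution_mollifier_subset hK hψc hψK] with n hn
    rw [← hdu.2 _ ((hasCompactSupport_mollifier n).contDiff_convolution_right (lsmul ℝ ℝ)
      iψ.locallyIntegrable (contDiff_mollifier n)) hn.1 hn.2]
    have e1 : ∀ x, partialDeriv i (ψ ⋆[lsmul ℝ ℝ, volume] mollifier d n) x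
        = (K.indicator h ⋆[lsmul ℝ ℝ, volume] mollifier d n) x := fun x => by
      rw [partialDeriv_convolution iψ.locallyIntegrable (contDiff_mollifier n)
        (hasCompactSupport_mollifier n), convolution_mollifier_eq]
      have := hdv.integral_mul_test hK hKb hv hCv hφ hφc hφK (contDiff_mollifier n) x
      rw [← integral_indicator mK, ← integral_indicator mK] at this
      refine (integral_congr_ae (Eventually.of_forall fun t => ?_)).trans (this.trans
        (integral_congr_ae (Eventually.of_forall fun t => ?_)))
      · by_cases ht : t ∈ K
        · simp [ht, hψ]
        · simp [ht, hψ, hφ0 t ht]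
      · by_cases ht : t ∈ K <;> simp [ht, hh]
    simp_rw [e1]
    rw [← integral_indicator mK, ← integral_indicator mK]
    have := integral_mul_convolution_mollifier_comm iU iH n
    refine (integral_congr_ae (Eventually.of_forall fun t => ?_)).trans (this.symm.trans
        (integral_congr_ae (Eventually.of_forall fun t => ?_)))
    · by_cases ht : t ∈ K <;> simp [ht]
    · by_cases ht : t ∈ K <;> simp [ht]
  have lim1 : Tendsto (fun n => ∫ x in K,
      (K.indicator u ⋆[lsmul ℝ ℝ, volume] mollifier d n) x * h x) atTop
      (𝓝 (∫ x in K, u x * h x)) := by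
    refine tendsto_integral_of_dominated_convergence (fun x => |Cu| * ‖h x‖) (fun n => ?_)
      (ih.norm.const_mul _) (fun n => Eventually.of_forall fun x => ?_) ?_
    · exact (continuous_convolution_mollifier iU.locallyIntegrable n).aestronglyMeasurable.mul
        ih.aestronglyMeasurable
    · rw [norm_mul]
      exact mul_le_mul_of_nonneg_right (abs_convolution_mollifier_le hUb n x) (norm_nonneg _)
    · refine (ae_restrict_iff' mK).2 (Eventually.of_forall fun x hx => ?_)
      have hc : ContinuousAt (K.indicator u) x := by
        refine (hu.continuousAt (hK.mem_nhds hx)).congr ?_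
        filter_upwards [hK.mem_nhds hx] with y hy
        simp [hy]
      have := tendsto_convolution_mollifier iU.aestronglyMeasurable hc
      simp only [hx, Set.indicator_of_mem] at this
      exact this.mul_const _
  have lim2 : Tendsto (fun n => ∫ x in K,
      du x * (ψ ⋆[lsmul ℝ ℝ, volume] mollifier d n) x) atTop
      (𝓝 (∫ x in K, du x * ψ x)) := by
    refine tendsto_integral_of_dominated_convergence (fun x => ‖du x‖ * (|Cv| * |A|))
      (fun n => ?_) (hdu.1.norm.mul_const _) (fun n => Eventually.of_forall fun x => ?_) ?_
    · exact hdu.1.aestronglyMeasurable.mul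
        (continuous_convolution_mollifier iψ.locallyIntegrable n).aestronglyMeasurable
    · rw [norm_mul]
      exact mul_le_mul_of_nonneg_left (abs_convolution_mollifier_le hψb n x) (norm_nonneg _)
    · refine (ae_restrict_iff' mK).2 (Eventually.of_forall fun x hx => ?_)
      have hc : ContinuousAt ψ x :=
        (hv.continuousAt (hK.mem_nhds hx)).mul cφ.continuousAt
      exact (tendsto_convolution_mollifier iψ.aestronglyMeasurable hc).const_mul _
  have fin := tendsto_nhds_unique (lim1.congr' hid) lim2.neg
  have k1 := integrableOn_mul_of_continuousOn mK hu hCu i2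
  have k2 := integrableOn_mul_of_continuousOn mK hu hCu i3
  have k3 : IntegrableOn (fun t => du t * ψ t) K volume := by
    refine (Integrable.mul_bdd j2 cφ.aestronglyMeasurable (Eventually.of_forall hA)).congr
      (Eventually.of_forall fun t => ?_)
    simp only [hψ]; ring
  have s1 : ∫ x in K, u x * h x = (∫ x in K, u x * (v x * partialDeriv i φ x))
      + ∫ x in K, u x * (dv x * φ x) := by
    rw [← integral_add k1 k2]
    congr 1; ext t; simp only [hh]; ring
  have s2 : ∫ x in K, (u x * dv x + v x * du x) * φ x = (∫ x in K, u x * (dv x * φ x))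
      + ∫ x in K, du x * ψ x := by
    rw [← integral_add k2 k3]
    congr 1; ext t; simp only [hψ]; ring
  have s3 : ∫ x in K, u x * v x * partialDeriv i φ x
      = ∫ x in K, u x * (v x * partialDeriv i φ x) := by
    congr 1; ext t; ring
  linarith

end Mollification

/-! ### The weak chain rule -/

section ChainRule

open scoped Polynomial

lemma integral_partialDeriv_eq_zero {i : Fin d} {φ : E d → ℝ} (hφ : ContDiff ℝ ∞ φ)
    (hφc : HasCompactSupport φ) : ∫ x, partialDeriv i φ x = 0 := by
  have h1 : Integrable (partialDeriv i φ) volume :=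
    (continuous_partialDeriv hφ).integrable_of_hasCompactSupport
      (hasCompactSupport_partialDeriv hφc)
  have := integral_mul_fderiv_eq_neg_fderiv_mul_of_integrable (μ := (volume : Measure (E d)))
    (f := fun _ => (1 : ℝ)) (g := φ) (v := EuclideanSpace.single i (1 : ℝ)) (by simp)
    (by simp only [one_mul]; exact h1)
    (by simpa using hφ.continuous.integrable_of_hasCompactSupport hφc)
    (by fun_prop) (fun x _ => hφ.differentiable (by simp) x)
  simpa [partialDeriv] using this

lemma isWeakPartial_const {K : Set (E d)} (i : Fin d) (c : ℝ) :
    IsWeakPartial K i (fun _ => c) (fun _ => 0) := by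
  refine ⟨integrableOn_zero, fun φ hφ hφc hφK => ?_⟩
  rw [integral_const_mul, setIntegral_eq_integral_of_forall_compl_eq_zero
    (fun x hx => partialDeriv_eq_zero_of_notMem_tsupport fun h => hx (hφK h)),
    integral_partialDeriv_eq_zero hφ hφc]
  simp

lemma IsWeakPartial.add {K : Set (E d)} {i : Fin d} {u v du dv : E d → ℝ}
    (hu : IntegrableOn u K volume) (hv : IntegrableOn v K volume)
    (hdu : IsWeakPartial K i u du) (hdv : IsWeakPartial K i v dv) :
    IsWeakPartial K i (fun x => u x + v x) (fun x => du x + dv x) := by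
  refine ⟨hdu.1.add hdv.1, fun φ hφ hφc hφK => ?_⟩
  obtain ⟨A, hA⟩ := hφc.exists_bound_of_continuous hφ.continuous
  have cdφ := continuous_partialDeriv (i := i) hφ
  obtain ⟨B, hB⟩ := (hasCompactSupport_partialDeriv (i := i) hφc).exists_bound_of_continuous cdφ
  simp_rw [add_mul]
  rw [integral_add (Integrable.mul_bdd hu cdφ.aestronglyMeasurable (Eventually.of_forall hB))
    (Integrable.mul_bdd hv cdφ.aestronglyMeasurable (Eventually.of_forall hB)),
    integral_add (Integrable.mul_bdd hdu.1 hφ.continuous.aestronglyMeasurable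
      (Eventually.of_forall hA)) (Integrable.mul_bdd hdv.1 hφ.continuous.aestronglyMeasurable
      (Eventually.of_forall hA)), hdu.2 φ hφ hφc hφK, hdv.2 φ hφ hφc hφK]
  ring

lemma exists_bound_comp {K : Set (E d)} {u : E d → ℝ} {C : ℝ} (hC : ∀ x ∈ K, |u x| ≤ C)
    {f : ℝ → ℝ} (hf : Continuous f) : ∃ M, ∀ x ∈ K, |f (u x)| ≤ M := by
  obtain ⟨M, hM⟩ := (isCompact_Icc (a := -C) (b := C)).exists_bound_of_continuousOn hf.continuousOn
  exact ⟨M, fun x hx => hM _ (abs_le.1 (hC x hx))⟩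

/-- Weak chain rule for polynomials, by induction with the weak product rule. -/
lemma IsWeakPartial.polynomial_comp {K : Set (E d)} (hK : IsOpen K)
    (hKb : Bornology.IsBounded K) {i : Fin d} {u du : E d → ℝ}
    (hu : ContinuousOn u K) {C : ℝ} (hC : ∀ x ∈ K, |u x| ≤ C) (hdu : IsWeakPartial K i u du)
    (p : ℝ[X]) :
    IsWeakPartial K i (fun x => p.eval (u x)) (fun x => p.derivative.eval (u x) * du x) := by
  induction p using Polynomial.induction_on with
  | C a => simpa using isWeakPartial_const i a
  | add p q hp hq =>
    obtain ⟨A, hA⟩ := exists_bound_comp hC p.continuous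
    obtain ⟨B, hB⟩ := exists_bound_comp hC q.continuous
    have := IsWeakPartial.add
      (integrableOn_of_continuousOn_of_bounded hK.measurableSet hKb
        (p.continuous.comp_continuousOn hu) hA)
      (integrableOn_of_continuousOn_of_bounded hK.measurableSet hKb
        (q.continuous.comp_continuousOn hu) hB) hp hq
    convert this using 2 <;> simp [add_mul]
  | monomial n a ih =>
    obtain ⟨A, hA⟩ := exists_bound_comp hC (Polynomial.C a * Polynomial.X ^ n).continuous
    have := IsWeakPartial.mul hK hKb
      ((Polynomial.C a * Polynomial.X ^ n).continuous.comp_continuousOn hu) hA hu hC ih hdu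
    convert this using 2 with x x
    · simp [pow_succ, mul_assoc]
    · rw [pow_succ, ← mul_assoc, Polynomial.derivative_mul (f := Polynomial.C a * Polynomial.X ^ n)]
      simp only [Polynomial.eval_add, Polynomial.eval_mul, Polynomial.eval_X,
        Polynomial.derivative_X, Polynomial.eval_one, Polynomial.eval_C, Polynomial.eval_pow]
      ring

lemma exists_polynomial_derivative_eq (p : ℝ[X]) (c : ℝ) :
    ∃ q : ℝ[X], q.derivative = p ∧ q.eval 0 = c := by
  suffices h : ∃ q : ℝ[X], q.derivative = p by
    obtain ⟨q, hq⟩ := h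
    exact ⟨q + Polynomial.C (c - q.eval 0), by simp [hq], by simp⟩
  induction p using Polynomial.induction_on' with
  | add p q hp hq =>
    obtain ⟨p', rfl⟩ := hp
    obtain ⟨q', rfl⟩ := hq
    exact ⟨p' + q', by simp⟩
  | monomial n a =>
    refine ⟨Polynomial.monomial (n + 1) (a / (n + 1)), ?_⟩
    rw [Polynomial.derivative_monomial]
    have : (n + 1 : ℝ) ≠ 0 := by positivity
    simp [div_mul_cancel₀ _ this]

/-- A `C¹` function is approximated, together with its derivative, by polynomials. -/
lemma exists_polynomial_near_C1 {F : ℝ → ℝ} (hF : ContDiff ℝ 1 F) (C : ℝ) {ε : ℝ} (hε : 0 < ε) :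
    ∃ q : ℝ[X], ∀ t, |t| ≤ C → |q.eval t - F t| ≤ ε * C ∧
      |q.derivative.eval t - deriv F t| ≤ ε := by
  obtain ⟨p, hp⟩ := exists_polynomial_near_of_continuousOn (-C) C (deriv F)
    (hF.continuous_deriv le_rfl).continuousOn ε hε
  obtain ⟨q, rfl, hq0⟩ := exists_polynomial_derivative_eq p (F 0)
  refine ⟨q, fun t ht => ⟨?_, (hp t (abs_le.1 ht)).le⟩⟩
  have hC0 : 0 ≤ C := (abs_nonneg t).trans ht
  have := (convex_Icc (-C) C).norm_image_sub_le_of_norm_deriv_le (𝕜 := ℝ)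
    (f := fun t => q.eval t - F t) (C := ε) (x := 0) (y := t)
    (fun x _ => q.differentiableAt.sub (hF.differentiable one_ne_zero x))
    (fun x hx => ?_) ⟨by linarith, hC0⟩ (abs_le.1 ht)
  · simp only [hq0, sub_self, sub_zero, Real.norm_eq_abs] at this
    exact this.trans (mul_le_mul_of_nonneg_left ht hε.le)
  · rw [deriv_fun_sub q.differentiableAt (hF.differentiable one_ne_zero x), Polynomial.deriv]
    exact (hp x hx).le

/-- Weak chain rule for a bounded continuous function: the polynomial case follows from the product
rule, and the general one by `C¹` approximation on the range of `u`. -/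
theorem IsWeakPartial.comp {K : Set (E d)} (hK : IsOpen K)
    (hKb : Bornology.IsBounded K) {i : Fin d} {u du : E d → ℝ}
    (hu : ContinuousOn u K) {C : ℝ} (hC : ∀ x ∈ K, |u x| ≤ C) (hdu : IsWeakPartial K i u du)
    {F : ℝ → ℝ} (hF : ContDiff ℝ 1 F) :
    IsWeakPartial K i (fun x => F (u x)) (fun x => deriv F (u x) * du x) := by
  have mK := hK.measurableSet
  have cF' := hF.continuous_deriv le_rfl
  obtain ⟨M, hM⟩ := exists_bound_comp hC hF.continuous
  obtain ⟨M', hM'⟩ := exists_bound_comp hC cF'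
  refine ⟨integrableOn_mul_of_continuousOn mK (cF'.comp_continuousOn hu) hM' hdu.1,
    fun φ hφ hφc hφK => ?_⟩
  have cφ := hφ.continuous
  have cdφ := continuous_partialDeriv (i := i) hφ
  obtain ⟨A, hA⟩ := hφc.exists_bound_of_continuous cφ
  have hε : ∀ n : ℕ, (0 : ℝ) < 1 / (n + 1) := fun n => by positivity
  have hε1 : ∀ n : ℕ, (1 : ℝ) / (n + 1) ≤ 1 := fun n => by
    rw [div_le_one (by positivity)]; linarith [(Nat.cast_nonneg n : (0 : ℝ) ≤ n)]
  choose q hq using fun n : ℕ => exists_polynomial_near_C1 hF C (hε n)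
  have hlim := tendsto_one_div_add_atTop_nhds_zero_nat (𝕜 := ℝ)
  have lim1 : Tendsto (fun n => ∫ x in K, (q n).eval (u x) * partialDeriv i φ x) atTop
      (𝓝 (∫ x in K, F (u x) * partialDeriv i φ x)) := by
    refine tendsto_integral_of_dominated_convergence
      (fun x => (M + |C|) * ‖partialDeriv i φ x‖) (fun n => ?_) ?_ (fun n => ?_) ?_
    · exact (((q n).continuous.comp_continuousOn hu).mul
        cdφ.continuousOn).aestronglyMeasurable mK
    · exact ((cdφ.integrable_of_hasCompactSupport
        (hasCompactSupport_partialDeriv hφc)).norm.const_mul _).integrableOn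
    · refine (ae_restrict_iff' mK).2 (Eventually.of_forall fun x hx => ?_)
      rw [norm_mul]
      refine mul_le_mul_of_nonneg_right ?_ (norm_nonneg _)
      have h1 := (hq n _ (hC x hx)).1
      have h2 : 1 / ((n : ℝ) + 1) * C ≤ |C| := by
        refine (mul_le_mul_of_nonneg_left (le_abs_self C) (hε n).le).trans ?_
        exact mul_le_of_le_one_left (abs_nonneg _) (hε1 n)
      have h3 := hM x hx
      rw [Real.norm_eq_abs]
      have h4 := abs_sub_abs_le_abs_sub ((q n).eval (u x)) (F (u x))
      linarith
    · refine (ae_restrict_iff' mK).2 (Eventually.of_forall fun x hx => Tendsto.mul_const _ ?_)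
      rw [tendsto_iff_dist_tendsto_zero]
      refine squeeze_zero (fun n => dist_nonneg) (fun n => (hq n _ (hC x hx)).1) ?_
      simpa using hlim.mul_const C
  have lim2 : Tendsto (fun n => ∫ x in K, (q n).derivative.eval (u x) * du x * φ x) atTop
      (𝓝 (∫ x in K, deriv F (u x) * du x * φ x)) := by
    refine tendsto_integral_of_dominated_convergence
      (fun x => (M' + 1) * ‖du x‖ * A) (fun n => ?_) ((hdu.1.norm.const_mul _).mul_const _)
      (fun n => ?_) ?_
    · exact ((((q n).derivative.continuous.comp_continuousOn hu).aestronglyMeasurable mK).mul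
        hdu.1.aestronglyMeasurable).mul cφ.aestronglyMeasurable
    · refine (ae_restrict_iff' mK).2 (Eventually.of_forall fun x hx => ?_)
      have h1 := (hq n _ (hC x hx)).2
      have h3 := hM' x hx
      have h4 := abs_sub_abs_le_abs_sub ((q n).derivative.eval (u x)) (deriv F (u x))
      have h5 : ‖(q n).derivative.eval (u x)‖ ≤ M' + 1 := by
        rw [Real.norm_eq_abs]; linarith [hε1 n]
      rw [norm_mul, norm_mul]
      have : 0 ≤ M' + 1 := (norm_nonneg _).trans h5
      gcongr
      exact hA x
    · refine (ae_restrict_iff' mK).2 (Eventually.of_forall fun x hx =>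
        Tendsto.mul_const _ (Tendsto.mul_const _ ?_))
      rw [tendsto_iff_dist_tendsto_zero]
      exact squeeze_zero (fun n => dist_nonneg) (fun n => (hq n _ (hC x hx)).2) hlim
  refine tendsto_nhds_unique (lim1.congr fun n => ?_) lim2.neg
  exact (hdu.polynomial_comp hK hKb hu hC (q n)).2 φ hφ hφc hφK

end ChainRule

/-! ### Surface measure on hyperplanes -/

/-- The isometric parametrisation of `ℝ^{k+1}` by a coordinate along the unit vector `n` and the
coordinates in the hyperplane orthogonal to `n`. It preserves the volume. -/
lemma exists_hyperplane_frame {k : ℕ} {n : E (k + 1)} (hn : ‖n‖ = 1) :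
    ∃ L : E k →ₗᵢ[ℝ] E (k + 1), (∀ y, inner ℝ n (L y) = 0) ∧
      (∀ x, inner ℝ n x = 0 → ∃ y, L y = x) ∧
      MeasurePreserving (fun p : ℝ × E k => p.1 • n + L p.2) (volume.prod volume) volume := by
  obtain ⟨b, hb⟩ := Orthonormal.exists_orthonormalBasis_extension_of_card_eq (𝕜 := ℝ)
    (E := E (k + 1)) (ι := Fin (k + 1)) (by simp) (v := fun _ => n) (s := {0}) (by
      rw [orthonormal_iff_ite]
      rintro ⟨i, hi⟩ ⟨j, hj⟩
      simp only [Set.mem_singleton_iff] at hi hj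
      subst hi; subst hj
      simp [Set.domRestrict, hn])
  have hb0 : b 0 = n := hb 0 rfl
  let c : E k →ₗ[ℝ] E (k + 1) :=
    { toFun := fun y => WithLp.toLp 2 (Fin.cons 0 y.ofLp)
      map_add' := fun x y => by
        ext i; refine Fin.cases ?_ (fun i => ?_) i <;> simp
      map_smul' := fun a y => by
        ext i; refine Fin.cases ?_ (fun i => ?_) i <;> simp }
  let c' : E k →ₗᵢ[ℝ] E (k + 1) := ⟨c, fun y => by
    simp [c, EuclideanSpace.norm_eq, Fin.sum_univ_succ]⟩
  have hc' : ∀ y, c' y = WithLp.toLp 2 (Fin.cons 0 y.ofLp) := fun y => rfl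
  have hinner : ∀ x, inner ℝ n x = b.repr x 0 := fun x => by
    rw [OrthonormalBasis.repr_apply_apply, hb0]
  refine ⟨b.repr.symm.toLinearIsometry.comp c', fun y => ?_, fun x hx => ?_, ?_⟩
  · rw [hinner]; simp [hc']
  · rw [hinner] at hx
    refine ⟨WithLp.toLp 2 (fun i => b.repr x i.succ), ?_⟩
    simp only [LinearIsometry.coe_comp, Function.comp_apply, hc']
    apply b.repr.injective
    ext i
    refine Fin.cases ?_ (fun i => ?_) i <;> simp [hx]
  · have h1 : MeasurePreserving (fun p : ℝ × E k => (p.1, p.2.ofLp))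
        (volume.prod volume) (volume.prod volume) :=
      (MeasurePreserving.id volume).prod (PiLp.volume_preserving_ofLp (Fin k))
    have h2 := ((volume_preserving_piFinSuccAbove (fun _ : Fin (k + 1) => ℝ) 0).symm).comp h1
    have h3 := (PiLp.volume_preserving_toLp (Fin (k + 1))).comp h2
    have h4 := b.repr.symm.measurePreserving.comp h3
    have heq : (fun p : ℝ × E k => p.1 • n + (b.repr.symm.toLinearIsometry.comp c') p.2)
        = fun p : ℝ × E k => b.repr.symm (WithLp.toLp 2
          ((MeasurableEquiv.piFinSuccAbove (fun _ : Fin (k + 1) => ℝ) 0).symm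
            (p.1, p.2.ofLp))) := by
      funext p
      change p.1 • n + b.repr.symm (c' p.2) = _
      rw [← hb0, ← b.repr_symm_single 0, ← map_smul, ← map_add, hc']
      congr 1
      ext i
      refine Fin.cases ?_ (fun i => ?_) i <;>
        simp [MeasurableEquiv.piFinSuccAbove_symm_apply, Fin.insertNthEquiv]
    rw [heq]
    exact h4

/-- The surface measure on a hyperplane is the volume in isometric coordinates. -/
lemma map_volume_hyperplane {k : ℕ} {n : E (k + 1)} (hn : ‖n‖ = 1) {L : E k →ₗᵢ[ℝ] E (k + 1)}
    (hL : ∀ y, inner ℝ n (L y) = 0) (hL' : ∀ x, inner ℝ n x = 0 → ∃ y, L y = x) (b : ℝ) :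
    (volume : Measure (E k)).map (fun y => b • n + L y)
      = (μHE[k] : Measure (E (k + 1))).restrict {x | inner ℝ n x = b} := by
  have hiso : Isometry (fun y => b • n + L y) :=
    (isometry_add_left (b • n)).comp L.isometry
  have hr : Set.range (fun y => b • n + L y) = {x | inner ℝ n x = b} := by
    ext x
    constructor
    · rintro ⟨y, rfl⟩
      simp [inner_add_right, inner_smul_right, hL, hn]
    · intro hx
      obtain ⟨y, hy⟩ := hL' (x - b • n) (by
        simp only [Set.mem_ofPred_eq] at hx
        simp [inner_sub_right, inner_smul_right, hn, hx])
      exact ⟨y, by simp [hy]⟩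
  rw [← EuclideanSpace.euclideanHausdorffMeasure_eq_volume, hiso.map_euclideanHausdorffMeasure, hr]

lemma measurableEmbedding_hyperplane {k : ℕ} (n : E (k + 1)) (L : E k →ₗᵢ[ℝ] E (k + 1)) (b : ℝ) :
    MeasurableEmbedding (fun y => b • n + L y) :=
  ((isometry_add_left (b • n)).comp L.isometry).isClosedEmbedding.measurableEmbedding

/-- Surface integrals over a part of a hyperplane, in isometric coordinates. -/
lemma setIntegral_hyperplane {k : ℕ} {n : E (k + 1)} (hn : ‖n‖ = 1) {L : E k →ₗᵢ[ℝ] E (k + 1)}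
    (hL : ∀ y, inner ℝ n (L y) = 0) (hL' : ∀ x, inner ℝ n x = 0 → ∃ y, L y = x) {b : ℝ}
    {S : Set (E (k + 1))} (hS : MeasurableSet S) (hSb : S ⊆ {x | inner ℝ n x = b})
    (f : E (k + 1) → ℝ) :
    ∫ x in S, f x ∂μHE[k]
      = ∫ y, ((fun y => b • n + L y) ⁻¹' S).indicator (fun y => f (b • n + L y)) y := by
  have h := (measurableEmbedding_hyperplane n L b).setIntegral_map (μ := volume) f S
  rw [map_volume_hyperplane hn hL hL' b, Measure.restrict_restrict hS,
    Set.inter_eq_left.2 hSb] at h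
  rw [h, integral_indicator ((measurableEmbedding_hyperplane n L b).measurable hS)]

/-- Two non-parallel hyperplanes meet in a set of zero `k`-dimensional measure: in coordinates on
the first one, the intersection is a proper affine subspace. -/
lemma volume_inner_eq_const {k : ℕ} {n m : E (k + 1)} (hn : ‖n‖ = 1) (hm : ‖m‖ = 1)
    {L : E k →ₗᵢ[ℝ] E (k + 1)} (hL' : ∀ x, inner ℝ n x = 0 → ∃ y, L y = x)
    (h1 : m ≠ n) (h2 : m ≠ -n) (b c : ℝ) :
    volume {y : E k | inner ℝ m (b • n + L y) = c} = 0 := by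
  -- the component of `m` orthogonal to `n` is nonzero
  set a := inner ℝ n m with ha
  obtain ⟨z, hz⟩ := hL' (m - a • n) (by simp [inner_sub_right, inner_smul_right, hn, ha])
  have hz0 : inner ℝ m (L z) ≠ 0 := by
    rw [hz, inner_sub_right, inner_smul_right, real_inner_self_eq_norm_sq, hm, real_inner_comm,
      ← ha]
    intro h0
    have h3 : (a - 1) * (a + 1) = 0 := by nlinarith
    rcases mul_eq_zero.1 h3 with h | h
    · exact h1 ((inner_eq_one_iff_of_norm_eq_one (𝕜 := ℝ) hn hm).1 (by linarith)).symm
    · have : inner ℝ (-n) m = 1 := by rw [inner_neg_left]; linarith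
      exact h2 ((inner_eq_one_iff_of_norm_eq_one (by simpa using hn) hm).1 this).symm
  let ℓ : E k →ₗ[ℝ] ℝ := (innerSL ℝ m).toLinearMap ∘ₗ L.toLinearMap
  have hℓ : ∀ y, ℓ y = inner ℝ m (L y) := fun y => rfl
  by_cases hne : ∃ y₀, ℓ y₀ = c - b * inner ℝ m n
  · obtain ⟨y₀, hy₀⟩ := hne
    have hset : {y : E k | inner ℝ m (b • n + L y) = c}
        = (AffineSubspace.mk' y₀ (LinearMap.ker ℓ) : AffineSubspace ℝ (E k)) := by
      ext y
      simp only [Set.mem_ofPred_eq, inner_add_right, inner_smul_right, SetLike.mem_coe,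
        AffineSubspace.mem_mk', vsub_eq_sub, LinearMap.mem_ker, map_sub, hy₀, ← hℓ]
      constructor <;> intro h <;> linarith
    rw [hset]
    refine Measure.addHaar_affineSubspace volume _ fun htop => hz0 ?_
    have hd : (AffineSubspace.mk' y₀ (LinearMap.ker ℓ)).direction = ⊤ := by
      rw [htop, AffineSubspace.direction_top]
    rw [AffineSubspace.direction_mk'] at hd
    have : z ∈ LinearMap.ker ℓ := by rw [hd]; trivial
    exact this
  · have : {y : E k | inner ℝ m (b • n + L y) = c} = ∅ := by
      ext y
      simp only [Set.mem_ofPred_eq, inner_add_right, inner_smul_right, Set.mem_empty_iff_false,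
        iff_false]
      intro h
      exact hne ⟨y, by rw [hℓ]; linarith⟩
    rw [this, measure_empty]

/-- Two non-parallel hyperplanes meet in a set of zero surface measure. -/
lemma surfaceMeasure_inter_hyperplanes {d : ℕ} {n m : E d} (hn : ‖n‖ = 1) (hm : ‖m‖ = 1)
    (h1 : m ≠ n) (h2 : m ≠ -n) (b c : ℝ) :
    (μHE[d - 1] : Measure (E d)) {x | inner ℝ n x = b ∧ inner ℝ m x = c} = 0 := by
  rcases d with _ | k
  · exfalso
    have : n = 0 := Subsingleton.elim _ _
    simp [this] at hn
  obtain ⟨L, hL, hL', -⟩ := exists_hyperplane_frame hn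
  have hms : MeasurableSet {x : E (k + 1) | inner ℝ m x = c} :=
    (isClosed_eq (by fun_prop) continuous_const).measurableSet
  have h := volume_inner_eq_const hn hm hL' h1 h2 b c
  have e := congrArg (fun μ => μ {x : E (k + 1) | inner ℝ m x = c})
    (map_volume_hyperplane hn hL hL' b)
  simp only [(measurableEmbedding_hyperplane n L b).map_apply, Measure.restrict_apply hms] at e
  have hs : {x : E (k + 1) | inner ℝ n x = b ∧ inner ℝ m x = c}
      = {x | inner ℝ m x = c} ∩ {x | inner ℝ n x = b} := by
    ext x; exact and_comm
  simp only [Nat.add_sub_cancel]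
  rw [hs, ← e]
  exact h

/-! ### Convex polytopes and cutoff functions -/

lemma ConvexPolytope.isOpen_cell (P : ConvexPolytope d) : IsOpen P.cell := by
  have : P.cell = ⋂ n ∈ P.normals, {x | inner ℝ n x < P.offset n} := by
    ext x; simp [ConvexPolytope.cell]
  rw [this]
  exact isOpen_biInter_finset fun n _ => isOpen_lt (by fun_prop) continuous_const

lemma ConvexPolytope.isBounded_cell (P : ConvexPolytope d) : Bornology.IsBounded P.cell := P.bounded

lemma ConvexPolytope.isCompact_closure_cell (P : ConvexPolytope d) : IsCompact (closure P.cell) :=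
  P.isBounded_cell.isCompact_closure

lemma ConvexPolytope.inner_le_of_mem_closure (P : ConvexPolytope d) {x : E d}
    (hx : x ∈ closure P.cell) {n : E d} (hn : n ∈ P.normals) : inner ℝ n x ≤ P.offset n := by
  have hc : IsClosed {x : E d | inner ℝ n x ≤ P.offset n} :=
    isClosed_le (by fun_prop) continuous_const
  exact closure_minimal (fun y hy => (hy n hn).le) hc hx

lemma ConvexPolytope.isClosed_facet (P : ConvexPolytope d) (n : E d) : IsClosed (P.facet n) :=
  isClosed_closure.inter (isClosed_eq (by fun_prop) continuous_const)

/-- The half-space opposite to a tight one is not tight: otherwise the cell would be empty. -/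
lemma ConvexPolytope.inner_neg_lt (P : ConvexPolytope d) {x n : E d} (hn : n ∈ P.normals)
    (hx : inner ℝ n x = P.offset n) (hn' : -n ∈ P.normals) :
    inner ℝ (-n) x < P.offset (-n) := by
  obtain ⟨z, hz⟩ := P.nonempty
  have h1 := hz n hn
  have h2 := hz (-n) hn'
  rw [inner_neg_left] at h2 ⊢
  linarith

/-- Moving from a point of the closure in a direction pointing strictly inside all tight
half-spaces leads into the cell. -/
lemma ConvexPolytope.eventually_add_smul_mem_cell (P : ConvexPolytope d) {x e : E d}
    (hx : ∀ m ∈ P.normals, inner ℝ m x ≤ P.offset m)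
    (he : ∀ m ∈ P.normals, inner ℝ m x = P.offset m → inner ℝ m e < 0) :
    ∀ᶠ s in 𝓝[>] (0 : ℝ), x + s • e ∈ P.cell := by
  have : ∀ m ∈ P.normals, ∀ᶠ s in 𝓝[>] (0 : ℝ), inner ℝ m (x + s • e) < P.offset m := by
    intro m hm
    rcases (hx m hm).lt_or_eq with h | h
    · have hc : Continuous fun s : ℝ => inner ℝ m (x + s • e) := by fun_prop
      have : ∀ᶠ s in 𝓝 (0 : ℝ), inner ℝ m (x + s • e) < P.offset m :=
        hc.continuousAt.eventually_lt_const (by simpa using h)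
      exact nhdsWithin_le_nhds this
    · filter_upwards [self_mem_nhdsWithin] with s hs
      have hs : 0 < s := hs
      rw [inner_add_right, inner_smul_right, h]
      nlinarith [he m hm h]
  exact ((Finset.eventually_all _).2 this)

/-- A smooth monotone transition from `0` on `(-∞, 1]` to `1` on `[2, ∞)`. -/
noncomputable def cutoff (t : ℝ) : ℝ := Real.smoothTransition (t - 1)

lemma contDiff_cutoff : ContDiff ℝ ∞ cutoff :=
  Real.smoothTransition.contDiff.comp (contDiff_id.sub contDiff_const)

lemma cutoff_of_le {t : ℝ} (h : t ≤ 1) : cutoff t = 0 :=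
  Real.smoothTransition.zero_of_nonpos (by linarith)

lemma cutoff_of_ge {t : ℝ} (h : 2 ≤ t) : cutoff t = 1 :=
  Real.smoothTransition.one_of_one_le (by linarith)

lemma cutoff_nonneg (t : ℝ) : 0 ≤ cutoff t := Real.smoothTransition.nonneg _

lemma cutoff_le_one (t : ℝ) : cutoff t ≤ 1 := Real.smoothTransition.le_one _

lemma continuous_deriv_cutoff : Continuous (deriv cutoff) :=
  contDiff_cutoff.continuous_deriv (by simp)

lemma deriv_cutoff_of_lt {t : ℝ} (h : t < 1) : deriv cutoff t = 0 := by
  have : cutoff =ᶠ[𝓝 t] fun _ => 0 := by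
    filter_upwards [Iio_mem_nhds h] with s hs
    exact cutoff_of_le (le_of_lt hs)
  rw [this.deriv_eq]; simp

lemma deriv_cutoff_of_gt {t : ℝ} (h : 2 < t) : deriv cutoff t = 0 := by
  have : cutoff =ᶠ[𝓝 t] fun _ => 1 := by
    filter_upwards [Ioi_mem_nhds h] with s hs
    exact cutoff_of_ge (le_of_lt hs)
  rw [this.deriv_eq]; simp

lemma hasCompactSupport_deriv_cutoff : HasCompactSupport (deriv cutoff) := by
  refine HasCompactSupport.intro (isCompact_Icc (a := (1 : ℝ)) (b := 2)) fun t ht => ?_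
  rw [Set.mem_Icc, not_and_or, not_le, not_le] at ht
  exact ht.elim deriv_cutoff_of_lt deriv_cutoff_of_gt

lemma integrable_deriv_cutoff : Integrable (deriv cutoff) volume :=
  continuous_deriv_cutoff.integrable_of_hasCompactSupport hasCompactSupport_deriv_cutoff

lemma integral_deriv_cutoff : ∫ t, deriv cutoff t = 1 := by
  have h := integral_of_hasDerivAt_of_tendsto (f := cutoff) (f' := deriv cutoff) (m := 0) (n := 1)
    (fun t => ((contDiff_cutoff.differentiable (by simp)) t).hasDerivAt) integrable_deriv_cutoff
    (tendsto_const_nhds.congr' (by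
      filter_upwards [eventually_le_atBot (1 : ℝ)] with t ht
      rw [cutoff_of_le ht]))
    (tendsto_const_nhds.congr' (by
      filter_upwards [eventually_ge_atTop (2 : ℝ)] with t ht
      rw [cutoff_of_ge ht]))
  rw [h]; norm_num

/-! ### Concentration on a facet -/

lemma norm_le_norm_frame {k : ℕ} {n : E (k + 1)} (hn : ‖n‖ = 1) {L : E k →ₗᵢ[ℝ] E (k + 1)}
    (hL : ∀ y, inner ℝ n (L y) = 0) (s : ℝ) (y : E k) : ‖y‖ ≤ ‖s • n + L y‖ := by
  have h := norm_add_sq_real (s • n) (L y)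
  rw [inner_smul_left, hL, norm_smul, hn, L.norm_map] at h
  simp only [mul_zero, add_zero, mul_one] at h
  exact le_of_sq_le_sq (by rw [h]; nlinarith [sq_nonneg ‖s‖]) (norm_nonneg _)

/-- The derivative of the cutoff at scale `ε` along the normal `n` concentrates on the facet with
normal `n`. After the substitution `⟪n, x⟫ = offset n - ε t` the integrands converge pointwise off
the hyperplanes of the other facets, and dominated convergence applies. -/
lemma ConvexPolytope.tendsto_layer_succ {k : ℕ} (P : ConvexPolytope (k + 1)) {n : E (k + 1)}
    (hn : n ∈ P.normals) {W : E (k + 1) → ℝ} (hW : ContinuousOn W (closure P.cell)) {ε : ℕ → ℝ}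
    (hε : ∀ j, 0 < ε j) (hε0 : Tendsto ε atTop (𝓝 0)) :
    Tendsto (fun j => ∫ x in P.cell, W x *
        (∏ m ∈ P.normals.erase n, cutoff ((P.offset m - inner ℝ m x) / ε j)) *
        ((ε j)⁻¹ * deriv cutoff ((P.offset n - inner ℝ n x) / ε j))) atTop
      (𝓝 (∫ x in P.facet n, W x ∂μHE[k])) := by
  have hn1 := P.norm_normal n hn
  have hinn : inner ℝ n n = (1 : ℝ) := by rw [real_inner_self_eq_norm_sq, hn1]; norm_num
  obtain ⟨L, hL, hL', hA⟩ := exists_hyperplane_frame hn1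
  have mcell := P.isOpen_cell.measurableSet
  set b := P.offset n with hb
  set V : E (k + 1) → ℝ := P.cell.indicator W with hV
  set Q : ℕ → E (k + 1) → ℝ := fun j x =>
    ∏ m ∈ P.normals.erase n, cutoff ((P.offset m - inner ℝ m x) / ε j) with hQ
  have cθ' := continuous_deriv_cutoff
  have cQ : ∀ j, Continuous (Q j) := fun j =>
    continuous_finsetProd _ fun m _ => contDiff_cutoff.continuous.comp (by fun_prop)
  have hQ1 : ∀ j x, |Q j x| ≤ 1 := fun j x => by
    rw [abs_of_nonneg (Finset.prod_nonneg fun m _ => cutoff_nonneg _)]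
    exact Finset.prod_le_one (fun m _ => cutoff_nonneg _) fun m _ => cutoff_le_one _
  obtain ⟨C, hC⟩ := P.isCompact_closure_cell.exists_bound_of_continuousOn hW
  have hVb : ∀ x, |V x| ≤ |C| := fun x => by
    by_cases hx : x ∈ P.cell
    · simpa [hV, hx] using (hC x (subset_closure hx)).trans (le_abs_self C)
    · simp [hV, hx]
  have mV : Measurable V := by
    classical
    have := (hW.mono subset_closure).measurable_piecewise
      (continuousOn_const (c := (0 : ℝ)) (s := P.cellᶜ)) mcell
    convert this using 1
    ext x
    by_cases hx : x ∈ P.cell <;> simp [hV, hx]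
  obtain ⟨D, hD⟩ := hasCompactSupport_deriv_cutoff.exists_bound_of_continuous cθ'
  obtain ⟨R, hR⟩ := P.isBounded_cell.subset_closedBall 0
  -- the integrand in the original and in the rescaled coordinates
  set G : ℕ → E (k + 1) → ℝ := fun j x =>
    V x * Q j x * ((ε j)⁻¹ * deriv cutoff ((b - inner ℝ n x) / ε j)) with hG
  set X : ℕ → ℝ × E k → E (k + 1) := fun j p => (b - ε j * p.1) • n + L p.2 with hX
  set H : ℕ → ℝ × E k → ℝ := fun j p => V (X j p) * Q j (X j p) * deriv cutoff p.1 with hH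
  have cX : ∀ j, Continuous (X j) := fun j => by
    have := L.continuous
    fun_prop
  have mG : ∀ j, Measurable (G j) := fun j =>
    (mV.mul (cQ j).measurable).mul (continuous_const.mul (cθ'.comp (by fun_prop))).measurable
  have mH : ∀ j, Measurable (H j) := fun j =>
    ((mV.comp (cX j).measurable).mul ((cQ j).comp (cX j)).measurable).mul
      (cθ'.comp continuous_fst).measurable
  have iG : ∀ j, Integrable (G j) volume := fun j => by
    have h1 : IntegrableOn (G j) P.cell volume := by
      refine IntegrableOn.of_bound P.isBounded_cell.measure_lt_top (mG j).aestronglyMeasurable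
        (|C| * 1 * (|(ε j)⁻¹| * D)) (Eventually.of_forall fun x => ?_)
      simp only [hG, norm_mul, Real.norm_eq_abs]
      exact mul_le_mul (mul_le_mul (hVb x) (hQ1 j x) (abs_nonneg _) (abs_nonneg _))
        (mul_le_mul_of_nonneg_left (hD _) (abs_nonneg _)) (by positivity) (by positivity)
    rw [← integrable_indicator_iff mcell] at h1
    have h2 : P.cell.indicator (G j) = G j := by
      ext x
      by_cases hx : x ∈ P.cell <;> simp [hx, hG, hV]
    rwa [h2] at h1
  set g : ℝ × E k → ℝ := fun p =>
    (|C| * ‖deriv cutoff p.1‖) * (Metric.closedBall (0 : E k) R).indicator (fun _ => 1) p.2 with hg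
  have ig : Integrable g (volume.prod volume) := by
    refine (integrable_deriv_cutoff.norm.const_mul |C|).mul_prod ?_
    rw [integrable_indicator_iff Metric.isClosed_closedBall.measurableSet]
    exact integrableOn_const Metric.isBounded_closedBall.measure_lt_top.ne
  have hHg : ∀ j p, ‖H j p‖ ≤ g p := fun j p => by
    by_cases hx : X j p ∈ P.cell
    · have hball : p.2 ∈ Metric.closedBall (0 : E k) R := by
        rw [mem_closedBall_zero_iff]
        have := hR hx
        rw [mem_closedBall_zero_iff] at this
        exact (norm_le_norm_frame hn1 hL _ _).trans this
      simp only [hH, hg, hball, Set.indicator_of_mem, norm_mul, mul_one]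
      refine mul_le_mul_of_nonneg_right ?_ (norm_nonneg _)
      calc ‖V (X j p)‖ * ‖Q j (X j p)‖ ≤ |C| * 1 :=
            mul_le_mul (hVb _) (hQ1 _ _) (norm_nonneg _) (abs_nonneg _)
        _ = |C| := mul_one _
    · have : H j p = 0 := by simp [hH, hV, hx]
      rw [this, norm_zero]
      exact mul_nonneg (by positivity) (Set.indicator_nonneg (fun _ _ => zero_le_one) _)
  have iH : ∀ j, Integrable (H j) (volume.prod volume) := fun j =>
    ig.mono' (mH j).aestronglyMeasurable (Eventually.of_forall (hHg j))
  have hcov : ∀ j, ∫ x in P.cell, W x * Q j x *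
      ((ε j)⁻¹ * deriv cutoff ((b - inner ℝ n x) / ε j))
      = ∫ p, H j p ∂(volume.prod volume) := fun j => by
    have e1 : ∫ x in P.cell, W x * Q j x *
        ((ε j)⁻¹ * deriv cutoff ((b - inner ℝ n x) / ε j)) = ∫ x, G j x := by
      rw [← integral_indicator mcell]
      refine integral_congr_ae (Eventually.of_forall fun x => ?_)
      by_cases hx : x ∈ P.cell <;> simp [hx, hG, hV]
    have e2 : ∫ x, G j x = ∫ p : ℝ × E k, G j (p.1 • n + L p.2) ∂(volume.prod volume) := by
      rw [← hA.map_eq]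
      exact integral_map hA.measurable.aemeasurable (mG j).aestronglyMeasurable
    have e3 : ∫ p : ℝ × E k, G j (p.1 • n + L p.2) ∂(volume.prod volume)
        = ∫ s : ℝ, ∫ y, G j (s • n + L y) :=
      integral_prod _ (hA.integrable_comp_of_integrable (iG j))
    have e4 : ∫ s : ℝ, ∫ y, G j (s • n + L y)
        = ε j * ∫ t : ℝ, ∫ y, G j ((b - ε j * t) • n + L y) := by
      rw [← integral_sub_left_eq_self (fun s : ℝ => ∫ y, G j (s • n + L y)) volume b,
        Measure.integral_comp_mul_left (fun s : ℝ => ∫ y, G j ((b - s) • n + L y)) (ε j),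
        abs_of_pos (inv_pos.2 (hε j)), smul_eq_mul, ← mul_assoc,
        mul_inv_cancel₀ (hε j).ne', one_mul]
    rw [e1, e2, e3, e4, integral_prod _ (iH j), ← integral_const_mul]
    refine integral_congr_ae (Eventually.of_forall fun t => ?_)
    simp only
    rw [← integral_const_mul]
    refine integral_congr_ae (Eventually.of_forall fun y => ?_)
    have h1 : inner ℝ n ((b - ε j * t) • n + L y) = b - ε j * t := by
      rw [inner_add_right, inner_smul_right, hL, hinn]; ring
    have h2 : (b - (b - ε j * t)) / ε j = t := by
      field_simp [(hε j).ne']; ring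
    simp only [hG, hH, hX, h1, h2]
    have := (hε j).ne'
    field_simp
  refine Tendsto.congr (fun j => (hcov j).symm) ?_
  -- the limit
  set ι : E k → E (k + 1) := fun y => b • n + L y with hι
  have hιn : ∀ y, inner ℝ n (ι y) = b := fun y => by
    change inner ℝ n (b • n + L y) = b
    simp only [inner_add_right, inner_smul_right, hL, hinn]
    ring
  have hlim : ∫ x in P.facet n, W x ∂μHE[k] = ∫ p : ℝ × E k,
      deriv cutoff p.1 * (ι ⁻¹' P.facet n).indicator (fun y => W (ι y)) p.2
        ∂(volume.prod volume) := by
    rw [integral_prod_mul (μ := volume) (ν := volume) (deriv cutoff)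
      ((ι ⁻¹' P.facet n).indicator (fun y => W (ι y))), integral_deriv_cutoff, one_mul]
    exact setIntegral_hyperplane hn1 hL hL' (P.isClosed_facet n).measurableSet
      (fun x hx => hx.2) W
  rw [hlim]
  refine tendsto_integral_of_dominated_convergence g (fun j => (mH j).aestronglyMeasurable) ig
    (fun j => Eventually.of_forall (hHg j)) ?_
  -- almost every point of the hyperplane lies on no other face hyperplane
  have hae : ∀ᵐ y : E k, ∀ m ∈ P.normals.erase n, inner ℝ m (ι y) ≠ P.offset m := by
    rw [Finset.eventually_all]
    intro m hm
    obtain ⟨hmn, hm⟩ := Finset.mem_erase.1 hm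
    by_cases hm' : m = -n
    · refine Eventually.of_forall fun y => ?_
      subst hm'
      exact (P.inner_neg_lt hn (hιn y) hm).ne
    · have := volume_inner_eq_const hn1 (P.norm_normal m hm) hL' hmn hm' b (P.offset m)
      rw [ae_iff]
      simpa using this
  have hae' : ∀ᵐ p : ℝ × E k ∂(volume.prod volume),
      ∀ m ∈ P.normals.erase n, inner ℝ m (ι p.2) ≠ P.offset m :=
    Measure.quasiMeasurePreserving_snd.ae hae
  filter_upwards [hae'] with ⟨t, y⟩ hy
  simp only at hy
  simp only [hH]
  by_cases ht : deriv cutoff t = 0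
  · simp [ht]
  have htpos : 0 < t := by
    by_contra h
    exact ht (deriv_cutoff_of_lt (by linarith))
  have hXt : Tendsto (fun j => X j (t, y)) atTop (𝓝 (ι y)) := by
    have h1 : Tendsto (fun j => (b - ε j * t) • n + L y) atTop (𝓝 ((b - 0 * t) • n + L y)) :=
      ((tendsto_const_nhds.sub (hε0.mul_const t)).smul_const n).add_const _
    simpa [hX, hι] using h1
  by_cases hin : ∀ m ∈ P.normals.erase n, inner ℝ m (ι y) < P.offset m
  · have hle : ∀ m ∈ P.normals, inner ℝ m (ι y) ≤ P.offset m := fun m hm => by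
      by_cases hmn : m = n
      · rw [hmn, hιn]
      · exact (hin m (Finset.mem_erase.2 ⟨hmn, hm⟩)).le
    have hev := P.eventually_add_smul_mem_cell (x := ι y) (e := -n) hle fun m hm hme => by
      by_cases hmn : m = n
      · rw [hmn, inner_neg_right, hinn]; norm_num
      · exact absurd hme (hin m (Finset.mem_erase.2 ⟨hmn, hm⟩)).ne
    have hεt : Tendsto (fun j => ε j * t) atTop (𝓝[>] 0) := by
      refine tendsto_nhdsWithin_iff.2 ⟨?_, Eventually.of_forall fun j => mul_pos (hε j) htpos⟩
      simpa using hε0.mul_const t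
    have hXmem : ∀ᶠ j in atTop, X j (t, y) ∈ P.cell := by
      filter_upwards [hεt.eventually hev] with j hj
      convert hj using 1
      simp only [hX, hι]
      module
    have hcl : ι y ∈ closure P.cell := mem_closure_of_tendsto hXt hXmem
    have hVlim : Tendsto (fun j => V (X j (t, y))) atTop (𝓝 (W (ι y))) := by
      have h1 : Tendsto (fun j => X j (t, y)) atTop (𝓝[closure P.cell] (ι y)) :=
        tendsto_nhdsWithin_iff.2 ⟨hXt, hXmem.mono fun j hj => subset_closure hj⟩
      refine ((hW _ hcl).tendsto.comp h1).congr' ?_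
      filter_upwards [hXmem] with j hj
      simp [hV, hj]
    have hQlim : Tendsto (fun j => Q j (X j (t, y))) atTop (𝓝 1) := by
      have : Tendsto (fun j => ∏ m ∈ P.normals.erase n,
          cutoff ((P.offset m - inner ℝ m (X j (t, y))) / ε j)) atTop
          (𝓝 (∏ m ∈ P.normals.erase n, 1)) := by
        refine tendsto_finsetProd _ fun m hm => ?_
        have hnum : Tendsto (fun j => P.offset m - inner ℝ m (X j (t, y))) atTop
            (𝓝 (P.offset m - inner ℝ m (ι y))) :=
          tendsto_const_nhds.sub (tendsto_const_nhds.inner hXt)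
        have hinv : Tendsto (fun j => (ε j)⁻¹) atTop atTop :=
          tendsto_inv_nhdsGT_zero.comp (tendsto_nhdsWithin_iff.2
            ⟨hε0, Eventually.of_forall hε⟩)
        have hdiv := hnum.pos_mul_atTop (sub_pos.2 (hin m hm)) hinv
        refine tendsto_const_nhds.congr' ?_
        filter_upwards [hdiv.eventually_ge_atTop 2] with j hj
        rw [div_eq_mul_inv, cutoff_of_ge hj]
      simpa [hQ] using this
    have hf : y ∈ ι ⁻¹' P.facet n := ⟨hcl, hιn y⟩
    rw [Set.indicator_of_mem hf]
    have := (hVlim.mul hQlim).mul_const (deriv cutoff t)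
    convert this using 2
    ring
  · push Not at hin
    obtain ⟨m, hm, hmle⟩ := hin
    have hmlt : P.offset m < inner ℝ m (ι y) := lt_of_le_of_ne hmle (hy m hm).symm
    have hmn := (Finset.mem_erase.1 hm).2
    have hf : y ∉ ι ⁻¹' P.facet n := fun h =>
      absurd (P.inner_le_of_mem_closure h.1 hmn) (not_le.2 hmlt)
    rw [Set.indicator_of_notMem hf, mul_zero]
    refine tendsto_const_nhds.congr' ?_
    have hnum : Tendsto (fun j => inner ℝ m (X j (t, y))) atTop (𝓝 (inner ℝ m (ι y))) :=
      tendsto_const_nhds.inner hXt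
    filter_upwards [hnum.eventually_const_lt hmlt] with j hj
    have : X j (t, y) ∉ P.cell := fun h => absurd (h m hmn) (not_lt.2 hj.le)
    simp [hV, this]

/-! ### The divergence theorem on a convex polytope -/

lemma ConvexPolytope.tendsto_layer (P : ConvexPolytope d) {n : E d}
    (hn : n ∈ P.normals) {W : E d → ℝ} (hW : ContinuousOn W (closure P.cell)) {ε : ℕ → ℝ}
    (hε : ∀ j, 0 < ε j) (hε0 : Tendsto ε atTop (𝓝 0)) :
    Tendsto (fun j => ∫ x in P.cell, W x *
        (∏ m ∈ P.normals.erase n, cutoff ((P.offset m - inner ℝ m x) / ε j)) *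
        ((ε j)⁻¹ * deriv cutoff ((P.offset n - inner ℝ n x) / ε j))) atTop
      (𝓝 (∫ x in P.facet n, W x ∂μHE[d - 1])) := by
  rcases d with _ | k
  · have h := P.norm_normal n hn
    simp [Subsingleton.elim n 0] at h
  · exact P.tendsto_layer_succ hn hW hε hε0

/-- A smooth cutoff of the cell at scale `ε`: it vanishes outside the cell and within distance `ε` of
each bounding hyperplane, since the normals have unit length. -/
noncomputable def ConvexPolytope.cellCutoff (P : ConvexPolytope d) (ε : ℝ) (x : E d) : ℝ :=
  ∏ m ∈ P.normals, cutoff ((P.offset m - inner ℝ m x) / ε)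

namespace ConvexPolytope

variable (P : ConvexPolytope d)

lemma contDiff_cellCutoff (ε : ℝ) : ContDiff ℝ ∞ (P.cellCutoff ε) :=
  contDiff_prod fun _ _ => contDiff_cutoff.comp
    ((contDiff_const.sub (contDiff_const.inner ℝ contDiff_id)).div_const ε)

lemma partialDeriv_cellCutoff (i : Fin d) (ε : ℝ) (x : E d) :
    partialDeriv i (P.cellCutoff ε) x = - ∑ n ∈ P.normals, n i *
      ((∏ m ∈ P.normals.erase n, cutoff ((P.offset m - inner ℝ m x) / ε)) *
        (ε⁻¹ * deriv cutoff ((P.offset n - inner ℝ n x) / ε))) := by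
  have h1 : ∀ m ∈ P.normals, HasFDerivAt (fun x => cutoff ((P.offset m - inner ℝ m x) / ε))
      (deriv cutoff ((P.offset m - inner ℝ m x) / ε) • (ε⁻¹ • -(innerSL ℝ m))) x := by
    intro m _
    have h2 : HasFDerivAt (fun x : E d => (P.offset m - inner ℝ m x) / ε)
        (ε⁻¹ • -(innerSL ℝ m)) x :=
      (((innerSL ℝ m).hasFDerivAt (x := x)).const_sub (P.offset m)).mul_const ε⁻¹
    exact ((contDiff_cutoff.differentiable (by simp)) _).hasDerivAt.comp_hasFDerivAt x h2
  have h3 := HasFDerivAt.finsetProd h1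
  have h4 : fderiv ℝ (P.cellCutoff ε) x = _ := h3.fderiv
  rw [partialDeriv, h4, sum_apply, ← Finset.sum_neg_distrib]
  refine Finset.sum_congr rfl fun n _ => ?_
  have hin : inner ℝ n (EuclideanSpace.single i (1 : ℝ)) = n i := by
    simp [EuclideanSpace.inner_single_right]
  simp only [smul_apply, neg_apply, innerSL_apply_apply, hin, smul_eq_mul]
  ring

lemma cellCutoff_eq_zero {ε : ℝ} (hε : 0 < ε) {x m : E d} (hm : m ∈ P.normals)
    (hx : P.offset m - ε ≤ inner ℝ m x) : P.cellCutoff ε x = 0 :=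
  Finset.prod_eq_zero hm (cutoff_of_le (by rw [div_le_one hε]; linarith))

lemma abs_cellCutoff_le_one (ε : ℝ) (x : E d) : |P.cellCutoff ε x| ≤ 1 := by
  rw [cellCutoff, abs_of_nonneg (Finset.prod_nonneg fun m _ => cutoff_nonneg _)]
  exact Finset.prod_le_one (fun m _ => cutoff_nonneg _) fun m _ => cutoff_le_one _

lemma tsupport_cellCutoff_subset {ε : ℝ} (hε : 0 < ε) : tsupport (P.cellCutoff ε) ⊆ P.cell := by
  have hcl : IsClosed {x : E d | ∀ m ∈ P.normals, inner ℝ m x ≤ P.offset m - ε} := by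
    have : {x : E d | ∀ m ∈ P.normals, inner ℝ m x ≤ P.offset m - ε}
        = ⋂ m ∈ P.normals, {x | inner ℝ m x ≤ P.offset m - ε} := by
      ext x; simp
    rw [this]
    exact isClosed_biInter fun m _ => isClosed_le (by fun_prop) continuous_const
  have hsub : tsupport (P.cellCutoff ε)
      ⊆ {x : E d | ∀ m ∈ P.normals, inner ℝ m x ≤ P.offset m - ε} := by
    refine closure_minimal (fun x hx m hm => ?_) hcl
    by_contra h
    exact hx (P.cellCutoff_eq_zero hε hm (not_le.1 h).le)
  exact fun x hx m hm => (hsub hx m hm).trans_lt (by linarith)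

lemma hasCompactSupport_cellCutoff {ε : ℝ} (hε : 0 < ε) : HasCompactSupport (P.cellCutoff ε) :=
  P.isCompact_closure_cell.of_isClosed_subset (isClosed_tsupport _)
    ((P.tsupport_cellCutoff_subset hε).trans subset_closure)

lemma tendsto_cellCutoff {ε : ℕ → ℝ} (hε : ∀ j, 0 < ε j) (hε0 : Tendsto ε atTop (𝓝 0)) {x : E d}
    (hx : x ∈ P.cell) : Tendsto (fun j => P.cellCutoff (ε j) x) atTop (𝓝 1) := by
  have : Tendsto (fun j => P.cellCutoff (ε j) x) atTop (𝓝 (∏ m ∈ P.normals, 1)) := by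
    refine tendsto_finsetProd _ fun m hm => ?_
    have hinv : Tendsto (fun j => (ε j)⁻¹) atTop atTop :=
      tendsto_inv_nhdsGT_zero.comp (tendsto_nhdsWithin_iff.2 ⟨hε0, Eventually.of_forall hε⟩)
    have hdiv := hinv.const_mul_atTop (sub_pos.2 (hx m hm))
    refine tendsto_const_nhds.congr' ?_
    filter_upwards [hdiv.eventually_ge_atTop 2] with j hj
    rw [div_eq_mul_inv, cutoff_of_ge hj]
  simpa using this

/-- The divergence theorem on a convex polytope, for functions of class `W^{1,1}` that are
continuous up to the boundary. The weak derivative is tested with `φ` times the cutoff of the cell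
at scale `ε`, whose derivative concentrates on the facets as `ε → 0`. -/
theorem integral_weakPartial_mul {i : Fin d} {w g : E d → ℝ}
    (hw : IsWeakPartial P.cell i w g) {W : E d → ℝ} (hW : ContinuousOn W (closure P.cell))
    (hwW : Set.EqOn w W P.cell) {φ : E d → ℝ} (hφ : ContDiff ℝ ∞ φ) :
    ∫ x in P.cell, g x * φ x
      = ∑ n ∈ P.normals, n i * ∫ x in P.facet n, W x * φ x ∂μHE[d - 1]
        - ∫ x in P.cell, w x * partialDeriv i φ x := by
  set ε : ℕ → ℝ := fun j => 1 / (j + 1) with hεdef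
  have hε : ∀ j, 0 < ε j := fun j => by simp only [hεdef]; positivity
  have hε0 : Tendsto ε atTop (𝓝 0) := tendsto_one_div_add_atTop_nhds_zero_nat
  have mK := P.isOpen_cell.measurableSet
  have hWφ : ContinuousOn (fun x => W x * φ x) (closure P.cell) := hW.mul hφ.continuous.continuousOn
  have cdφ := continuous_partialDeriv (i := i) hφ
  have onK : ∀ f : E d → ℝ, ContinuousOn f (closure P.cell) → IntegrableOn f P.cell volume :=
    fun f hf => (hf.integrableOn_compact P.isCompact_closure_cell).mono_set subset_closure
  have igφ : IntegrableOn (fun x => g x * φ x) P.cell volume := by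
    obtain ⟨A, hA⟩ := P.isCompact_closure_cell.exists_bound_of_continuousOn
      hφ.continuous.continuousOn
    exact Integrable.mul_bdd hw.1 hφ.continuous.aestronglyMeasurable
      ((ae_restrict_iff' mK).2 (Eventually.of_forall fun x hx => hA x (subset_closure hx)))
  have iWdφ := onK _ (hW.mul cdφ.continuousOn)
  -- multiplication by the cutoffs disappears in the limit
  have hcut : ∀ f : E d → ℝ, IntegrableOn f P.cell volume →
      Tendsto (fun j => ∫ x in P.cell, f x * P.cellCutoff (ε j) x) atTop
        (𝓝 (∫ x in P.cell, f x)) := fun f hf => by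
    refine tendsto_integral_of_dominated_convergence (fun x => ‖f x‖) (fun j => ?_) hf.norm
      (fun j => Eventually.of_forall fun x => ?_) ?_
    · exact hf.aestronglyMeasurable.mul (P.contDiff_cellCutoff _).continuous.aestronglyMeasurable
    · rw [norm_mul]
      exact mul_le_of_le_one_right (norm_nonneg _) (P.abs_cellCutoff_le_one _ x)
    · refine (ae_restrict_iff' mK).2 (Eventually.of_forall fun x hx => ?_)
      simpa using (P.tendsto_cellCutoff hε hε0 hx).const_mul (f x)
  have hid : ∀ j, ∑ n ∈ P.normals, n i * (∫ x in P.cell, W x * φ x *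
        (∏ m ∈ P.normals.erase n, cutoff ((P.offset m - inner ℝ m x) / ε j)) *
        ((ε j)⁻¹ * deriv cutoff ((P.offset n - inner ℝ n x) / ε j)))
        - ∫ x in P.cell, W x * partialDeriv i φ x * P.cellCutoff (ε j) x
      = ∫ x in P.cell, g x * φ x * P.cellCutoff (ε j) x := fun j => by
    have hχ := P.contDiff_cellCutoff (ε j)
    have ht := hw.2 (fun x => φ x * P.cellCutoff (ε j) x) (hφ.mul hχ)
      (P.hasCompactSupport_cellCutoff (hε j)).mul_left
      ((tsupport_mul_subset_right).trans (P.tsupport_cellCutoff_subset (hε j)))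
    have ic : ∀ n ∈ P.normals, IntegrableOn (fun x => n i * (W x * φ x *
        (∏ m ∈ P.normals.erase n, cutoff ((P.offset m - inner ℝ m x) / ε j)) *
        ((ε j)⁻¹ * deriv cutoff ((P.offset n - inner ℝ n x) / ε j)))) P.cell volume :=
      fun n _ => onK _ (continuousOn_const.mul ((hWφ.mul (continuous_finsetProd _ fun m _ =>
        contDiff_cutoff.continuous.comp (by fun_prop)).continuousOn).mul
        (continuous_const.mul (continuous_deriv_cutoff.comp (by fun_prop))).continuousOn))
    have e1 : ∫ x in P.cell, w x * partialDeriv i (fun x => φ x * P.cellCutoff (ε j) x) x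
        = ∫ x in P.cell, (W x * partialDeriv i φ x * P.cellCutoff (ε j) x
          - ∑ n ∈ P.normals, n i * (W x * φ x *
        (∏ m ∈ P.normals.erase n, cutoff ((P.offset m - inner ℝ m x) / ε j)) *
        ((ε j)⁻¹ * deriv cutoff ((P.offset n - inner ℝ n x) / ε j)))) := by
      refine setIntegral_congr_fun mK fun x hx => ?_
      simp only
      rw [partialDeriv_mul (hφ.differentiable (by simp) x) (hχ.differentiable (by simp) x),
        P.partialDeriv_cellCutoff, hwW hx, mul_add, mul_neg, mul_neg, Finset.mul_sum,
        Finset.mul_sum, add_comm, ← sub_eq_add_neg]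
      congr 1
      · ring
      · refine Finset.sum_congr rfl fun n _ => ?_
        ring
    have i0 : IntegrableOn (fun x => W x * partialDeriv i φ x * P.cellCutoff (ε j) x)
        P.cell volume := onK _ ((hW.mul cdφ.continuousOn).mul hχ.continuous.continuousOn)
    rw [e1, integral_sub i0 (integrable_finsetSum _ ic), integral_finsetSum _ ic] at ht
    simp_rw [integral_const_mul, ← mul_assoc] at ht
    simp_rw [← mul_assoc]
    linarith
  have lim1 : Tendsto (fun j => ∑ n ∈ P.normals, n i * (∫ x in P.cell, W x * φ x *
        (∏ m ∈ P.normals.erase n, cutoff ((P.offset m - inner ℝ m x) / ε j)) *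
        ((ε j)⁻¹ * deriv cutoff ((P.offset n - inner ℝ n x) / ε j)))
        - ∫ x in P.cell, W x * partialDeriv i φ x * P.cellCutoff (ε j) x) atTop
      (𝓝 (∑ n ∈ P.normals, n i * ∫ x in P.facet n, W x * φ x ∂μHE[d - 1]
        - ∫ x in P.cell, W x * partialDeriv i φ x)) :=
    (tendsto_finsetSum _ fun n hn => (P.tendsto_layer hn hWφ hε hε0).const_mul (n i)).sub
      (hcut _ iWdφ)
  have e : ∫ x in P.cell, w x * partialDeriv i φ x = ∫ x in P.cell, W x * partialDeriv i φ x :=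
    setIntegral_congr_fun mK fun x hx => by simp only [hwW hx]
  rw [e]
  exact tendsto_nhds_unique (hcut _ igφ) (lim1.congr hid)

end ConvexPolytope

/-! ### Faces of a mesh -/

lemma ConvexPolytope.surfaceMeasure_facet_lt_top (P : ConvexPolytope d) {n : E d}
    (hn : n ∈ P.normals) : (μHE[d - 1] : Measure (E d)) (P.facet n) < ⊤ := by
  have hn1 := P.norm_normal n hn
  rcases d with _ | k
  · simp [Subsingleton.elim n 0] at hn1
  obtain ⟨L, hL, hL', -⟩ := exists_hyperplane_frame hn1
  have e := congrArg (fun μ => μ (P.facet n))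
    (map_volume_hyperplane hn1 hL hL' (P.offset n))
  simp only [(measurableEmbedding_hyperplane n L _).map_apply,
    Measure.restrict_apply (P.isClosed_facet n).measurableSet] at e
  rw [Set.inter_eq_left.2 (fun x hx => hx.2)] at e
  simp only [Nat.add_sub_cancel]
  rw [← e]
  obtain ⟨R, hR⟩ := P.isBounded_cell.closure.subset_closedBall 0
  refine lt_of_le_of_lt (measure_mono (t := Metric.closedBall 0 R) fun y hy => ?_)
    Metric.isBounded_closedBall.measure_lt_top
  have := hR hy.1
  rw [mem_closedBall_zero_iff] at this ⊢
  exact (norm_le_norm_frame hn1 hL _ _).trans this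

lemma ConvexPolytope.integrableOn_facet (P : ConvexPolytope d) {n : E d}
    (hn : n ∈ P.normals) {f : E d → ℝ} (hf : ContinuousOn f (closure P.cell)) :
    IntegrableOn f (P.facet n) (μHE[d - 1]) := by
  have hsub : P.facet n ⊆ closure P.cell := fun x hx => hx.1
  have mF := (P.isClosed_facet n).measurableSet
  obtain ⟨C, hC⟩ := P.isCompact_closure_cell.exists_bound_of_continuousOn hf
  exact IntegrableOn.of_bound (P.surfaceMeasure_facet_lt_top hn)
    ((hf.mono hsub).aestronglyMeasurable mF) C
    ((ae_restrict_iff' mF).2 (Eventually.of_forall fun x hx => hC x (hsub hx)))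

namespace Mesh

variable {Ω : Set (E d)} (T : Mesh d Ω)

/-- The point `x` lies on no face hyperplane of the mesh whose normal is not parallel to `n`. -/
def GenericFor (n x : E d) : Prop :=
  ∀ k, ∀ m ∈ (T.elem k).normals, inner ℝ m x = (T.elem k).offset m → m = n ∨ m = -n

variable {T}

lemma GenericFor.neg {n x : E d} (h : T.GenericFor n x) : T.GenericFor (-n) x :=
  fun k m hm hx => by simpa [or_comm] using h k m hm hx

lemma ae_genericFor {j : Fin T.N} {n : E d} (hn : n ∈ (T.elem j).normals) :
    ∀ᵐ x ∂(μHE[d - 1] : Measure (E d)), x ∈ (T.elem j).facet n → T.GenericFor n x := by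
  have h : ∀ k, ∀ m ∈ (T.elem k).normals, ∀ᵐ x ∂(μHE[d - 1] : Measure (E d)),
      x ∈ (T.elem j).facet n → inner ℝ m x = (T.elem k).offset m → m = n ∨ m = -n := by
    intro k m hm
    by_cases h1 : m = n
    · exact Eventually.of_forall fun _ _ _ => Or.inl h1
    by_cases h2 : m = -n
    · exact Eventually.of_forall fun _ _ _ => Or.inr h2
    have := surfaceMeasure_inter_hyperplanes ((T.elem j).norm_normal n hn)
      ((T.elem k).norm_normal m hm) h1 h2 ((T.elem j).offset n) ((T.elem k).offset m)
    filter_upwards [measure_eq_zero_iff_ae_notMem.1 this] with x hx hxf hxm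
    exact absurd ⟨hxf.2, hxm⟩ hx
  have h' := eventually_all.2 fun k => (Finset.eventually_all _).2 (h k)
  filter_upwards [h'] with x hx hxf k m hm
  exact hx k m hm hxf

/-- At a generic point of a facet, every other element touching the point has the opposite half-space
among its tight constraints. -/
lemma tight_of_mem_closure {j k : Fin T.N} (hjk : k ≠ j) {n x : E d}
    (hn : n ∈ (T.elem j).normals) (hx : x ∈ (T.elem j).facet n) (hg : T.GenericFor n x)
    (hk : x ∈ closure (T.cell k)) : -n ∈ (T.elem k).normals ∧
      inner ℝ (-n) x = (T.elem k).offset (-n) := by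
  -- otherwise the points `x - s n` lie in both cells for small `s > 0`
  by_contra hcon
  have hn1 : inner ℝ n n = (1 : ℝ) := by
    rw [real_inner_self_eq_norm_sq, (T.elem j).norm_normal n hn]; norm_num
  have hneg : ∀ m, m = n → inner ℝ m (-n) < (0 : ℝ) := fun m hm => by
    rw [hm, inner_neg_right, hn1]; norm_num
  have h1 := (T.elem j).eventually_add_smul_mem_cell (x := x) (e := -n)
    (fun m hm => (T.elem j).inner_le_of_mem_closure hx.1 hm) fun m hm hmx => by
      rcases hg j m hm hmx with h | h
      · exact hneg m h
      · subst h
        exact absurd hmx ((T.elem j).inner_neg_lt hn hx.2 hm).ne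
  have h2 := (T.elem k).eventually_add_smul_mem_cell (x := x) (e := -n)
    (fun m hm => (T.elem k).inner_le_of_mem_closure hk hm) fun m hm hmx => by
      rcases hg k m hm hmx with h | h
      · exact hneg m h
      · subst h
        exact absurd ⟨hm, hmx⟩ hcon
  obtain ⟨s, hs1, hs2⟩ := (h1.and h2).exists
  exact Set.disjoint_left.1 (T.cell_disjoint j k hjk.symm) hs1 hs2

/-- At most one further element touches a generic point of a facet. -/
lemma eq_of_mem_closure {j k k' : Fin T.N} (hjk : k ≠ j) (hjk' : k' ≠ j) {n x : E d}
    (hn : n ∈ (T.elem j).normals) (hx : x ∈ (T.elem j).facet n) (hg : T.GenericFor n x)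
    (hk : x ∈ closure (T.cell k)) (hk' : x ∈ closure (T.cell k')) : k = k' := by
  -- otherwise the points `x + s n` lie in both cells for small `s > 0`
  by_contra hcon
  have hn1 : inner ℝ n n = (1 : ℝ) := by
    rw [real_inner_self_eq_norm_sq, (T.elem j).norm_normal n hn]; norm_num
  have key : ∀ l, l ≠ j → x ∈ closure (T.cell l) →
      ∀ᶠ s in 𝓝[>] (0 : ℝ), x + s • n ∈ (T.elem l).cell := fun l hl hxl => by
    refine (T.elem l).eventually_add_smul_mem_cell
      (fun m hm => (T.elem l).inner_le_of_mem_closure hxl hm) fun m hm hmx => ?_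
    obtain ⟨ht1, ht2⟩ := tight_of_mem_closure hl hn hx hg hxl
    rcases hg l m hm hmx with h | h
    · subst h
      exact absurd hmx (by
        have := (T.elem l).inner_neg_lt ht1 ht2 (by simpa using hm)
        simpa using this.ne)
    · rw [h, inner_neg_left, hn1]; norm_num
  obtain ⟨s, hs1, hs2⟩ := ((key k hjk hk).and (key k' hjk' hk')).exists
  exact Set.disjoint_left.1 (T.cell_disjoint k k' hcon) hs1 hs2

/-- A facet point inside `Ω` is touched by a further element, because the elements cover `Ω`. -/
lemma exists_mem_closure (hΩ : IsOpen Ω) {j : Fin T.N} {n x : E d}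
    (hn : n ∈ (T.elem j).normals) (hx : x ∈ (T.elem j).facet n) (hxΩ : x ∈ Ω) :
    ∃ k, k ≠ j ∧ x ∈ closure (T.cell k) := by
  -- the points `x + s n`, `s > 0`, leave the element `j` but stay in `Ω`
  have hn1 : inner ℝ n n = (1 : ℝ) := by
    rw [real_inner_self_eq_norm_sq, (T.elem j).norm_normal n hn]; norm_num
  have hlim : Tendsto (fun s : ℝ => x + s • n) (𝓝[>] 0) (𝓝 x) := by
    have hc : Continuous fun s : ℝ => x + s • n := by fun_prop
    have := hc.tendsto 0
    simp only [zero_smul, add_zero] at this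
    exact this.mono_left nhdsWithin_le_nhds
  have hev : ∀ᶠ s in 𝓝[>] (0 : ℝ), ∃ k, k ≠ j ∧ x + s • n ∈ closure (T.cell k) := by
    filter_upwards [hlim.eventually (hΩ.mem_nhds hxΩ), self_mem_nhdsWithin] with s hs hs0
    have hs0 : 0 < s := hs0
    obtain ⟨k, hk⟩ := Set.mem_iUnion.1 (T.covers hs)
    refine ⟨k, fun h => ?_, hk⟩
    subst h
    have := (T.elem k).inner_le_of_mem_closure hk hn
    rw [inner_add_right, inner_smul_right, hn1, hx.2] at this
    linarith
  by_contra hcon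
  push Not at hcon
  have hout : ∀ᶠ y in 𝓝 x, ∀ k, k ≠ j → y ∉ closure (T.cell k) := by
    rw [eventually_all]
    intro k
    by_cases hk : k = j
    · exact Eventually.of_forall fun y h => absurd hk h
    · filter_upwards [isClosed_closure.isOpen_compl.mem_nhds (hcon k hk)] with y hy _
      exact hy
  obtain ⟨s, ⟨k, hk, hs⟩, hs'⟩ := (hev.and (hlim.eventually hout)).exists
  exact hs' k hk hs

lemma measurableSet_interiorFace (hΩ : IsOpen Ω) (j k : Fin T.N) (n : E d) :
    MeasurableSet (T.interiorFace j k n) :=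
  (((T.elem j).isClosed_facet n).measurableSet.inter isClosed_closure.measurableSet).inter
    hΩ.measurableSet

/-- Up to null sets, the part of a facet inside `Ω` is the disjoint union of the interior faces
shared with the other elements. -/
lemma setIntegral_facet_inter (hΩ : IsOpen Ω) {j : Fin T.N} {n : E d}
    (hn : n ∈ (T.elem j).normals) {f : E d → ℝ}
    (hf : IntegrableOn f ((T.elem j).facet n ∩ Ω) (μHE[d - 1])) :
    ∫ x in (T.elem j).facet n ∩ Ω, f x ∂μHE[d - 1]
      = ∑ k ∈ {j}ᶜ, ∫ x in T.interiorFace j k n, f x ∂μHE[d - 1] := by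
  classical
  have mS : MeasurableSet ((T.elem j).facet n ∩ Ω) :=
    ((T.elem j).isClosed_facet n).measurableSet.inter hΩ.measurableSet
  have hI : ∀ k, T.interiorFace j k n = closure (T.cell k) ∩ ((T.elem j).facet n ∩ Ω) :=
    fun k => by ext x; simp only [interiorFace, Set.mem_inter_iff]; tauto
  have mc : ∀ k, MeasurableSet (closure (T.cell k)) := fun k => isClosed_closure.measurableSet
  have e : ∀ k, ∫ x in T.interiorFace j k n, f x ∂μHE[d - 1]
      = ∫ x in (T.elem j).facet n ∩ Ω, (closure (T.cell k)).indicator f x ∂μHE[d - 1] := fun k => by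
    rw [integral_indicator (mc k), Measure.restrict_restrict (mc k), hI]
  simp_rw [e]
  rw [← integral_finsetSum _ fun k _ => hf.indicator (mc k)]
  refine setIntegral_congr_ae mS ?_
  filter_upwards [ae_genericFor hn] with x hg hx
  have hg := hg hx.1
  obtain ⟨k, hkj, hk⟩ := exists_mem_closure hΩ hn hx.1 hx.2
  rw [Finset.sum_eq_single k]
  · simp [hk]
  · intro l hl hlk
    refine Set.indicator_of_notMem (fun h => hlk ?_) _
    exact eq_of_mem_closure (by simpa using hl) hkj hn hx.1 hg h hk
  · intro h
    exact absurd hkj (by simpa using h)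

/-- An interior face seen from `K_j` is, up to a null set, contained in the one seen from `K_k`; it
is itself a null set if `-n` is not a normal of `K_k`. -/
lemma interiorFace_ae_le (j k : Fin T.N) (hjk : k ≠ j) {n : E d}
    (hn : n ∈ (T.elem j).normals) : ∀ᵐ x ∂(μHE[d - 1] : Measure (E d)),
      x ∈ T.interiorFace j k n → -n ∈ (T.elem k).normals ∧ x ∈ T.interiorFace k j (-n) := by
  filter_upwards [ae_genericFor hn] with x hg hx
  obtain ⟨h1, h2⟩ := tight_of_mem_closure hjk hn hx.1.1 (hg hx.1.1) hx.1.2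
  exact ⟨h1, ⟨⟨hx.1.2, h2⟩, hx.1.1.1⟩, hx.2⟩

/-- The two descriptions of an interior face, from either side, agree and have opposite normals. -/
lemma sum_interiorFace_swap (j k : Fin T.N) (hjk : k ≠ j) (i : Fin d)
    (h : E d → ℝ) :
    ∑ n ∈ (T.elem k).normals, n i * ∫ x in T.interiorFace k j n, h x ∂μHE[d - 1]
      = - ∑ n ∈ (T.elem j).normals, n i * ∫ x in T.interiorFace j k n, h x ∂μHE[d - 1] := by
  classical
  have key : ∀ j k : Fin T.N, k ≠ j →
      ∑ n ∈ (T.elem j).normals, n i * ∫ x in T.interiorFace j k n, h x ∂μHE[d - 1]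
      = ∑ n ∈ (T.elem j).normals with -n ∈ (T.elem k).normals,
        n i * ∫ x in T.interiorFace j k n, h x ∂μHE[d - 1] := fun j k hjk => by
    refine (Finset.sum_filter_of_ne fun n hn hne => ?_).symm
    by_contra hcon
    refine hne ?_
    rw [setIntegral_measure_zero, mul_zero]
    rw [measure_eq_zero_iff_ae_notMem]
    filter_upwards [interiorFace_ae_le j k hjk hn] with x hx hxi
    exact hcon (hx hxi).1
  rw [key j k hjk, key k j hjk.symm, ← Finset.sum_neg_distrib]
  refine Finset.sum_nbij' (fun n => -n) (fun n => -n) ?_ ?_ (by simp) (by simp) ?_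
  · intro n hn; simpa [and_comm] using hn
  · intro n hn; simpa [and_comm] using hn
  · intro n hn
    obtain ⟨hn1, hn2⟩ := Finset.mem_filter.1 hn
    have : ∫ x in T.interiorFace k j n, h x ∂μHE[d - 1]
        = ∫ x in T.interiorFace j k (-n), h x ∂μHE[d - 1] := by
      refine setIntegral_congr_set ?_
      filter_upwards [interiorFace_ae_le k j hjk.symm hn1, interiorFace_ae_le j k hjk hn2]
        with x h1 h2
      refine propext ⟨fun hx => (h1 hx).2, fun hx => ?_⟩
      have := (h2 hx).2
      rwa [neg_neg] at this
    rw [this]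
    simp

end Mesh

/-! ### The `L²` projection -/

lemma contDiff_mvPolynomial_eval (q : MvPolynomial (Fin d) ℝ) :
    ContDiff ℝ ∞ (fun x : E d => MvPolynomial.eval (fun a => x a) q) := by
  induction q using MvPolynomial.induction_on with
  | C a => simpa using contDiff_const
  | add p q hp hq => simpa using hp.add hq
  | mul_X p n hp =>
    have : ContDiff ℝ ∞ (fun x : E d => x n) := by fun_prop
    simpa using hp.mul this

lemma partialDeriv_mvPolynomial_eval (i : Fin d) (q : MvPolynomial (Fin d) ℝ) (x : E d) :
    partialDeriv i (fun x : E d => MvPolynomial.eval (fun a => x a) q) x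
      = MvPolynomial.eval (fun a => x a) (MvPolynomial.pderiv i q) := by
  have hd : ∀ q : MvPolynomial (Fin d) ℝ, DifferentiableAt ℝ
      (fun x : E d => MvPolynomial.eval (fun a => x a) q) x := fun q =>
    (contDiff_mvPolynomial_eval q).differentiable (by simp) x
  induction q using MvPolynomial.induction_on with
  | C a => simp [partialDeriv]
  | add p q hp hq =>
    simp only [map_add, ← hp, ← hq]
    simp only [partialDeriv]
    rw [fderiv_fun_add (hd p) (hd q)]
    rfl
  | mul_X p n hp =>
    have hX : partialDeriv i (fun x : E d => x n) x = if n = i then 1 else 0 := by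
      have : (fun x : E d => x n) = EuclideanSpace.proj (𝕜 := ℝ) n := rfl
      rw [partialDeriv, this, ContinuousLinearMap.fderiv]
      simp
    simp only [map_mul, MvPolynomial.eval_X]
    rw [partialDeriv_mul (hd p) (by fun_prop), hX, hp, MvPolynomial.pderiv_mul]
    by_cases h : n = i
    · subst h
      simp
      ring
    · simp [h, MvPolynomial.pderiv_X_of_ne h, mul_comm]

namespace Poly

variable {r : ℕ}

lemma contDiff_val (p : Poly d r) : ContDiff ℝ ∞ p.val := contDiff_mvPolynomial_eval _

lemma partialDeriv_val (i : Fin d) (p : Poly d r) (x : E d) :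
    partialDeriv i p.val x = p.partialVal i x := partialDeriv_mvPolynomial_eval i _ x

lemma val_add (p q : Poly d r) (x : E d) : (p + q).val x = p.val x + q.val x := by
  simp [Poly.val]

lemma val_smul (c : ℝ) (p : Poly d r) (x : E d) : (c • p).val x = c * p.val x := by
  simp [Poly.val, MvPolynomial.smul_eval]

/-- A polynomial is determined by its values on a nonempty open set: such a set contains a box. -/
lemma eq_zero_of_val_eq_zero {U : Set (E d)} (hU : IsOpen U) (hne : U.Nonempty) {p : Poly d r}
    (hp : ∀ x ∈ U, p.val x = 0) : p = 0 := by
  obtain ⟨x₀, hx₀⟩ := hne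
  have hU' : (WithLp.toLp 2 ⁻¹' U : Set (Fin d → ℝ)) ∈ 𝓝 x₀.ofLp :=
    (PiLp.continuous_toLp 2 _).continuousAt.preimage_mem_nhds (hU.mem_nhds hx₀)
  obtain ⟨ε, hε, hball⟩ := Metric.mem_nhds_iff.1 hU'
  have hsub : Set.pi Set.univ (fun a => Metric.ball (x₀.ofLp a) ε) ⊆ WithLp.toLp 2 ⁻¹' U := by
    rwa [← ball_pi _ hε]
  refine Subtype.ext (MvPolynomial.funext_set (fun a => Metric.ball (x₀.ofLp a) ε)
    (fun a => ?_) fun x hx => ?_)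
  · rw [Real.ball_eq_Ioo]
    exact Set.Ioo_infinite (by linarith)
  · have := hp _ (hsub hx)
    simpa [Poly.val] using this

end Poly

namespace Mesh

variable {Ω : Set (E d)} (T : Mesh d Ω) {r : ℕ}

lemma integrableOn_cell_of_continuous (j : Fin T.N) {f : E d → ℝ} (hf : Continuous f) :
    IntegrableOn f (T.cell j) volume :=
  (hf.continuousOn.integrableOn_compact (T.elem j).isCompact_closure_cell).mono_set subset_closure

lemma integrableOn_cell_mul {j : Fin T.N} {f g : E d → ℝ}
    (hf : IntegrableOn f (T.cell j) volume) (hg : Continuous g) :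
    IntegrableOn (fun x => f x * g x) (T.cell j) volume := by
  obtain ⟨A, hA⟩ := (T.elem j).isCompact_closure_cell.exists_bound_of_continuousOn hg.continuousOn
  exact Integrable.mul_bdd hf hg.aestronglyMeasurable
    ((ae_restrict_iff' (T.elem j).isOpen_cell.measurableSet).2
      (Eventually.of_forall fun x hx => hA x (subset_closure hx)))

/-- Integration against a piecewise integrable function, as a linear functional on `V_r^h`. -/
noncomputable def pairing (r : ℕ) (f : Fin T.N → E d → ℝ)
    (hf : ∀ j, IntegrableOn (f j) (T.cell j) volume) : T.DGSpace r →ₗ[ℝ] ℝ where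
  toFun φ := T.brokenInner f (fun j => (φ j).val)
  map_add' φ ψ := by
    simp only [brokenInner, ← Finset.sum_add_distrib]
    refine Finset.sum_congr rfl fun j _ => ?_
    rw [← integral_add (T.integrableOn_cell_mul (hf j) (φ j).contDiff_val.continuous)
      (T.integrableOn_cell_mul (hf j) (ψ j).contDiff_val.continuous)]
    simp only [Pi.add_apply, Poly.val_add, mul_add]
  map_smul' c φ := by
    simp only [brokenInner, RingHom.id_apply, smul_eq_mul, Finset.mul_sum]
    refine Finset.sum_congr rfl fun j _ => ?_
    rw [← integral_const_mul]
    simp only [Pi.smul_apply, Poly.val_smul, mul_left_comm]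

lemma brokenInner_comm (f g : Fin T.N → E d → ℝ) : T.brokenInner f g = T.brokenInner g f := by
  simp only [brokenInner, mul_comm]

/-- The `L²` inner product of `V_r^h`, as a map from `V_r^h` to its dual. -/
noncomputable def innerDual (r : ℕ) : T.DGSpace r →ₗ[ℝ] Module.Dual ℝ (T.DGSpace r) where
  toFun p := T.pairing r (fun j => (p j).val)
    fun j => T.integrableOn_cell_of_continuous j (p j).contDiff_val.continuous
  map_add' p q := by
    refine LinearMap.ext fun φ => ?_
    -- by symmetry, linearity in the first argument is linearity of the functional of `φ`
    change T.brokenInner _ _ = T.brokenInner _ _ + T.brokenInner _ _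
    simp only [T.brokenInner_comm _ (fun j => (φ j).val)]
    exact (T.pairing r (fun j => (φ j).val) fun j =>
      T.integrableOn_cell_of_continuous j (φ j).contDiff_val.continuous).map_add p q
  map_smul' c p := by
    refine LinearMap.ext fun φ => ?_
    change T.brokenInner _ _ = c * T.brokenInner _ _
    simp only [T.brokenInner_comm _ (fun j => (φ j).val)]
    exact (T.pairing r (fun j => (φ j).val) fun j =>
      T.integrableOn_cell_of_continuous j (φ j).contDiff_val.continuous).map_smul c p

/-- The broken `L²` product is definite on `V_r^h`: a polynomial whose square integrates to zero over
an open cell vanishes there, hence identically. -/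
lemma innerDual_injective (r : ℕ) : Function.Injective (T.innerDual r) := by
  rw [injective_iff_map_eq_zero]
  intro p hp
  have h0 : T.brokenInner (fun j => (p j).val) (fun j => (p j).val) = 0 :=
    LinearMap.congr_fun hp p
  have hnn : ∀ j ∈ Finset.univ, 0 ≤ ∫ x in T.cell j, (p j).val x * (p j).val x := fun j _ =>
    integral_nonneg fun x => mul_self_nonneg _
  funext j
  have hj := (Finset.sum_eq_zero_iff_of_nonneg hnn).1 h0 j (Finset.mem_univ j)
  have hc := (p j).contDiff_val.continuous
  have hopen : IsOpen (T.cell j) := (T.elem j).isOpen_cell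
  refine Poly.eq_zero_of_val_eq_zero hopen (T.elem j).nonempty ?_
  have hae := (setIntegral_eq_zero_iff_of_nonneg_ae
    (Eventually.of_forall fun x => mul_self_nonneg _)
    (T.integrableOn_cell_of_continuous j (hc.mul hc))).1 hj
  have heq := Measure.eqOn_open_of_ae_eq hae hopen (hc.mul hc).continuousOn
    continuousOn_const
  intro x hx
  simpa using heq hx

/-- The `L²` projection is well defined on piecewise integrable functions. -/
theorem existsUnique_isL2Projection (r : ℕ) {f : E d → ℝ}
    (hf : ∀ j, IntegrableOn f (T.cell j) volume) : ∃! p, T.IsL2Projection r f p := by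
  have hinj := T.innerDual_injective r
  have hsurj : Function.Surjective (T.innerDual r) :=
    (LinearMap.injective_iff_surjective_of_finrank_eq_finrank
      Subspace.dual_finrank_eq.symm).1 hinj
  obtain ⟨p, hp⟩ := hsurj (T.pairing r (fun _ => f) hf)
  refine ⟨p, fun φ => LinearMap.congr_fun hp φ, fun q hq => hinj ?_⟩
  rw [hp]
  refine LinearMap.ext fun φ => ?_
  exact hq φ

end Mesh

/-! ### Discrete derivatives of functions continuous in the domain -/

namespace Mesh

variable {Ω : Set (E d)} {T : Mesh d Ω}

/-- The trace from either side of a function continuous in `Ω` is the function itself. -/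
lemma trace_eq_of_continuousOn {j : Fin T.N} {w : E d → ℝ} (hw : ContinuousOn w Ω) {x : E d}
    (hx : x ∈ closure (T.cell j)) (hxΩ : x ∈ Ω) : T.trace j w x = w x :=
  extendFrom_eq hx ((hw x hxΩ).mono (T.cell_subset j))

lemma trace_eq_of_eqOn {j : Fin T.N} {w W : E d → ℝ} (hW : ContinuousOn W (closure (T.cell j)))
    (hwW : Set.EqOn w W (T.cell j)) {x : E d} (hx : x ∈ closure (T.cell j)) :
    T.trace j w x = W x := by
  refine extendFrom_eq hx (((hW x hx).mono subset_closure).tendsto.congr' ?_)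
  filter_upwards [self_mem_nhdsWithin] with y hy
  exact (hwW hy).symm

/-- For a function that is continuous in `Ω` the numerical traces `𝒬_i^±` are single-valued and the
jumps vanish. Summing the elementwise divergence theorem, the contributions of the two sides of each
interior face combine, so the defining relation of both discrete derivatives is that of the `L²`
projection of the weak derivative. -/
theorem isDiscretePartialSided_iff_isL2Projection (hΩ : IsOpen Ω) {r : ℕ} (γ : T.Penalty) (s : Side)
    (i : Fin d) {w g : E d → ℝ} (hw : T.MemVh w) (hwΩ : ContinuousOn w Ω)
    (hg : T.IsPartial i w g) (p : T.DGSpace r) :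
    T.IsDiscretePartialSided r γ s i w p ↔ T.IsL2Projection r g p := by
  refine forall_congr' fun φ => ?_
  suffices h : (T.interiorSum (fun j k n x => T.Q s i j k n w x * n i * ((φ j).val x - (φ k).val x))
        + T.boundarySum (fun j n x => T.trace j w x * n i * (φ j).val x))
      - T.brokenInner (fun _ => w) (fun j => (φ j).partialVal i)
      + T.interiorSum (fun j k _ x =>
          γ s i j k * T.jump j k w x * ((φ j).val x - (φ k).val x))
      = T.brokenInner (fun _ => g) (fun j => (φ j).val) by rw [h]
  have mI := fun j k n => measurableSet_interiorFace (T := T) hΩ j k n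
  have tr : ∀ {j k : Fin T.N} {n x : E d}, x ∈ T.interiorFace j k n →
      T.trace j w x = w x ∧ T.trace k w x = w x := fun hx =>
    ⟨trace_eq_of_continuousOn hwΩ hx.1.1.1 hx.2, trace_eq_of_continuousOn hwΩ hx.1.2 hx.2⟩
  choose W hW hwW using fun j => (hw j).2
  have hclΩ : ∀ j, closure (T.cell j) ⊆ closure Ω := fun j => closure_mono (T.cell_subset j)
  -- integrability on the faces
  have hF : ∀ j, ∀ n ∈ (T.elem j).normals, ∀ ψ : E d → ℝ, Continuous ψ →
      IntegrableOn (fun x => W j x * ψ x) ((T.elem j).facet n) (μHE[d - 1]) :=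
    fun j n hn ψ hψ => (T.elem j).integrableOn_facet hn ((hW j).mul hψ.continuousOn)
  have hWw : ∀ j n x, x ∈ (T.elem j).facet n ∩ Ω → W j x = w x := fun j n x hx => by
    rw [← trace_eq_of_eqOn (hW j) (hwW j) hx.1.1, trace_eq_of_continuousOn hwΩ hx.1.1 hx.2]
  have mFΩ : ∀ j n, MeasurableSet ((T.elem j).facet n ∩ Ω) := fun j n =>
    ((T.elem j).isClosed_facet n).measurableSet.inter hΩ.measurableSet
  have hFΩ : ∀ j, ∀ n ∈ (T.elem j).normals, ∀ ψ : E d → ℝ, Continuous ψ →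
      IntegrableOn (fun x => w x * ψ x) ((T.elem j).facet n ∩ Ω) (μHE[d - 1]) :=
    fun j n hn ψ hψ => ((hF j n hn ψ hψ).mono_set Set.inter_subset_left).congr_fun
      (fun x hx => by simp only [hWw j n x hx]) (mFΩ j n)
  have hI : ∀ j k, ∀ n ∈ (T.elem j).normals, ∀ ψ : E d → ℝ, Continuous ψ →
      IntegrableOn (fun x => w x * ψ x) (T.interiorFace j k n) (μHE[d - 1]) :=
    fun j k n hn ψ hψ => (hFΩ j n hn ψ hψ).mono_set fun x hx => ⟨hx.1.1, hx.2⟩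
  have hφc : ∀ j, Continuous (φ j).val := fun j => (φ j).contDiff_val.continuous
  -- the flux of `w φ_l` through the interior faces between `K_j` and `K_k`, out of `K_j`
  set a : Fin T.N → Fin T.N → Fin T.N → ℝ := fun l j k => ∑ n ∈ (T.elem j).normals,
    n i * ∫ x in T.interiorFace j k n, w x * (φ l).val x ∂μHE[d - 1] with ha
  have hpen : T.interiorSum (fun j k _ x =>
      γ s i j k * T.jump j k w x * ((φ j).val x - (φ k).val x)) = 0 := by
    refine Finset.sum_eq_zero fun j _ => Finset.sum_eq_zero fun k _ => Finset.sum_eq_zero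
      fun n _ => ?_
    refine setIntegral_eq_zero_of_forall_eq_zero fun x hx => ?_
    simp only [jump, (tr hx).1, (tr hx).2]
    ring
  have hint : T.interiorSum (fun j k n x =>
      T.Q s i j k n w x * n i * ((φ j).val x - (φ k).val x))
      = ∑ j, ∑ k ∈ Finset.Ioi j, (a j j k + a k k j) := by
    refine Finset.sum_congr rfl fun j _ => Finset.sum_congr rfl fun k hk => ?_
    have hkj : k ≠ j := (Finset.mem_Ioi.1 hk).ne'
    have e1 : a k k j = - a k j k := sum_interiorFace_swap j k hkj i _
    rw [e1, ← sub_eq_add_neg]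
    simp only [ha, ← Finset.sum_sub_distrib]
    refine Finset.sum_congr rfl fun n hn => ?_
    rw [← mul_sub, ← integral_sub (hI j k n hn _ (hφc j)) (hI j k n hn _ (hφc k)),
      ← integral_const_mul]
    refine setIntegral_congr_fun (mI j k n) fun x hx => ?_
    have hQ : T.Q s i j k n w x = w x := by
      cases s <;> simp only [Q, (tr hx).1, (tr hx).2, ite_self]
    simp only [hQ]
    ring
  have hfacet : ∀ j, ∀ n ∈ (T.elem j).normals,
      ∫ x in (T.elem j).facet n, W j x * (φ j).val x ∂μHE[d - 1]
      = (∑ k ∈ {j}ᶜ, ∫ x in T.interiorFace j k n, w x * (φ j).val x ∂μHE[d - 1])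
        + ∫ x in T.boundaryFace j n, W j x * (φ j).val x ∂μHE[d - 1] := fun j n hn => by
    have hsplit : (T.elem j).facet n = ((T.elem j).facet n ∩ Ω) ∪ T.boundaryFace j n := by
      rw [boundaryFace, ← Set.inter_union_distrib_left, hΩ.frontier_eq, Set.union_sdiff_self,
        eq_comm, Set.inter_eq_left]
      exact fun x hx => Or.inr (hclΩ j hx.1)
    have hdisj : Disjoint ((T.elem j).facet n ∩ Ω) (T.boundaryFace j n) := by
      rw [boundaryFace, hΩ.frontier_eq]
      exact Set.disjoint_left.2 fun x hx hx' => hx'.2.2 hx.2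
    have mB : MeasurableSet (T.boundaryFace j n) :=
      ((T.elem j).isClosed_facet n).measurableSet.inter isClosed_frontier.measurableSet
    have hall := hF j n hn _ (hφc j)
    have e := setIntegral_union hdisj mB
      (hall.mono_set Set.inter_subset_left) (hall.mono_set Set.inter_subset_left)
    rw [← hsplit] at e
    rw [e, ← setIntegral_facet_inter hΩ hn (hFΩ j n hn _ (hφc j))]
    congr 1
    exact setIntegral_congr_fun (mFΩ j n) fun x hx => by simp only [hWw j n x hx]
  have hbdry : T.boundarySum (fun j n x => T.trace j w x * n i * (φ j).val x)
      = ∑ j, ∑ n ∈ (T.elem j).normals,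
        n i * ∫ x in T.boundaryFace j n, W j x * (φ j).val x ∂μHE[d - 1] := by
    refine Finset.sum_congr rfl fun j _ => Finset.sum_congr rfl fun n _ => ?_
    rw [← integral_const_mul]
    refine setIntegral_congr_fun (((T.elem j).isClosed_facet n).measurableSet.inter
      isClosed_frontier.measurableSet) fun x hx => ?_
    simp only [trace_eq_of_eqOn (hW j) (hwW j) hx.1.1]
    ring
  have hcells : T.brokenInner (fun _ => g) (fun j => (φ j).val)
      = ∑ j, ((∑ k ∈ {j}ᶜ, a j j k) + (∑ n ∈ (T.elem j).normals,
          n i * ∫ x in T.boundaryFace j n, W j x * (φ j).val x ∂μHE[d - 1])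
        - ∫ x in T.cell j, w x * (φ j).partialVal i x) := by
    refine Finset.sum_congr rfl fun j _ => ?_
    have h := (T.elem j).integral_weakPartial_mul (hg j) (hW j) (hwW j) (φ j).contDiff_val
    simp only [Poly.partialDeriv_val] at h
    refine h.trans (congrArg₂ _ ?_ rfl)
    rw [ha, Finset.sum_comm, ← Finset.sum_add_distrib]
    refine Finset.sum_congr rfl fun n hn => ?_
    rw [hfacet j n hn, mul_add, Finset.mul_sum]
  rw [hpen, hint, hbdry, hcells, add_zero, Finset.sum_sub_distrib, Finset.sum_add_distrib,
    Finset.sum_sum_Ioi_add_eq_sum_sum_off_diag (fun k j => a j j k)]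
  rfl

/-- Discrete and projected weak derivatives of a function continuous in `Ω` agree. -/
theorem discretePartial_eq_L2Projection (hΩ : IsOpen Ω) {r : ℕ} (γ : T.Penalty)
    (i : Fin d) {w g : E d → ℝ} (hw : T.MemVh w) (hwΩ : ContinuousOn w Ω)
    (hg : T.IsPartial i w g) :
    T.discretePartial r γ i w = T.L2Projection r g := by
  have h : ∀ s, T.discretePartialSided r γ s i w = T.L2Projection r g := fun s => by
    rw [discretePartialSided, L2Projection]
    congr 1
    funext p
    exact propext (isDiscretePartialSided_iff_isL2Projection hΩ γ s i hw hwΩ hg p)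
  rw [discretePartial, h, h, ← two_smul ℝ, smul_smul]
  norm_num

theorem existsUnique_isDiscretePartialSided (hΩ : IsOpen Ω) {r : ℕ} (γ : T.Penalty)
    (s : Side) (i : Fin d) {w : E d → ℝ} (hw : T.MemVh w) (hwΩ : ContinuousOn w Ω) :
    ∃! p, T.IsDiscretePartialSided r γ s i w p := by
  choose g hg using fun j => (hw j).1.2 i
  -- glue the weak derivatives of the elements, which are disjoint
  classical
  let G : E d → ℝ := fun x => ∑ j, (T.cell j).indicator (g j) x
  have hG : ∀ j, Set.EqOn (g j) G (T.cell j) := fun j x hx => by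
    simp only [G]
    rw [Finset.sum_eq_single j, Set.indicator_of_mem hx]
    · intro k _ hk
      exact Set.indicator_of_notMem
        (fun h => Set.disjoint_left.1 (T.cell_disjoint j k hk.symm) hx h) _
    · simp
  have hP : T.IsPartial i w G := fun j => by
    have mK : MeasurableSet (T.cell j) := (T.elem j).isOpen_cell.measurableSet
    refine ⟨(hg j).1.congr_fun (hG j) mK, fun φ h1 h2 h3 => ?_⟩
    rw [(hg j).2 φ h1 h2 h3]
    congr 1
    exact setIntegral_congr_fun mK fun x hx => by simp only [hG j hx]
  simp_rw [isDiscretePartialSided_iff_isL2Projection hΩ γ s i hw hwΩ hP]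
  exact T.existsUnique_isL2Projection r fun j => (hP j).1

lemma MemVh.exists_bound {w : E d → ℝ} (hw : T.MemVh w) (j : Fin T.N) :
    ContinuousOn w (T.cell j) ∧ ∃ C, ∀ x ∈ T.cell j, |w x| ≤ C := by
  obtain ⟨W, hW, hwW⟩ := (hw j).2
  obtain ⟨C, hC⟩ := (T.elem j).isCompact_closure_cell.exists_bound_of_continuousOn hW
  refine ⟨(hW.mono subset_closure).congr hwW, C, fun x hx => ?_⟩
  rw [hwW hx]
  exact hC x (subset_closure hx)

theorem IsPartial.mul {i : Fin d} {u v du dv : E d → ℝ} (hu : T.MemVh u) (hv : T.MemVh v)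
    (hdu : T.IsPartial i u du) (hdv : T.IsPartial i v dv) :
    T.IsPartial i (fun x => u x * v x) (fun x => u x * dv x + v x * du x) := fun j => by
  obtain ⟨cu, Cu, hCu⟩ := hu.exists_bound j
  obtain ⟨cv, Cv, hCv⟩ := hv.exists_bound j
  exact IsWeakPartial.mul (T.elem j).isOpen_cell (T.elem j).isBounded_cell cu hCu cv hCv
    (hdu j) (hdv j)

theorem IsPartial.comp {i : Fin d} {u du : E d → ℝ} (hu : T.MemVh u)
    (hdu : T.IsPartial i u du) {F : ℝ → ℝ} (hF : ContDiff ℝ 1 F) :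
    T.IsPartial i (fun x => F (u x)) (fun x => deriv F (u x) * du x) := fun j => by
  obtain ⟨cu, Cu, hCu⟩ := hu.exists_bound j
  exact IsWeakPartial.comp (T.elem j).isOpen_cell (T.elem j).isBounded_cell cu hCu (hdu j) hF

lemma integrableOn_of_memC0Closure {j : Fin T.N} {w : E d → ℝ} (hw : MemC0Closure (T.cell j) w) :
    IntegrableOn w (T.cell j) volume := by
  obtain ⟨W, hW, hwW⟩ := hw
  exact ((hW.integrableOn_compact (T.elem j).isCompact_closure_cell).mono_set
    subset_closure).congr_fun (fun x hx => (hwW hx).symm) (T.elem j).isOpen_cell.measurableSet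

theorem MemVh.mul {u v : E d → ℝ} (hu : T.MemVh u) (hv : T.MemVh v) :
    T.MemVh (fun x => u x * v x) := fun j => by
  obtain ⟨cu, Cu, hCu⟩ := hu.exists_bound j
  obtain ⟨cv, Cv, hCv⟩ := hv.exists_bound j
  obtain ⟨U, hU, huU⟩ := (hu j).2
  obtain ⟨V, hV, hvV⟩ := (hv j).2
  have hc : MemC0Closure (T.cell j) (fun x => u x * v x) :=
    ⟨fun x => U x * V x, hU.mul hV, fun x hx => by simp only [huU hx, hvV hx]⟩
  refine ⟨⟨integrableOn_of_memC0Closure hc, fun i => ?_⟩, hc⟩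
  obtain ⟨du, hdu⟩ := (hu j).1.2 i
  obtain ⟨dv, hdv⟩ := (hv j).1.2 i
  exact ⟨_, IsWeakPartial.mul (T.elem j).isOpen_cell (T.elem j).isBounded_cell cu hCu cv hCv
    hdu hdv⟩

theorem MemVh.comp {u : E d → ℝ} (hu : T.MemVh u) {F : ℝ → ℝ} (hF : ContDiff ℝ 1 F) :
    T.MemVh (fun x => F (u x)) := fun j => by
  obtain ⟨cu, Cu, hCu⟩ := hu.exists_bound j
  obtain ⟨U, hU, huU⟩ := (hu j).2
  have hc : MemC0Closure (T.cell j) (fun x => F (u x)) :=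
    ⟨fun x => F (U x), hF.continuous.comp_continuousOn hU, fun x hx => by simp only [huU hx]⟩
  refine ⟨⟨integrableOn_of_memC0Closure hc, fun i => ?_⟩, hc⟩
  obtain ⟨du, hdu⟩ := (hu j).1.2 i
  exact ⟨_, IsWeakPartial.comp (T.elem j).isOpen_cell (T.elem j).isBounded_cell cu hCu hdu hF⟩

lemma IsPartial.integrableOn_iUnion {i : Fin d} {w g : E d → ℝ} (hg : T.IsPartial i w g) :
    IntegrableOn g (⋃ j, T.cell j) volume :=
  integrableOn_finite_iUnion.2 fun j => (hg j).1

end Mesh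

end DGCalculus

theorem mainTheorem8 (d r : ℕ) (Ω : Set (DGCalculus.E d)) (hΩ : IsOpen Ω)
    (T : DGCalculus.Mesh d Ω) (γ : T.Penalty)
    (F : ℝ → ℝ) (hF : ContDiff ℝ 1 F) (hF' : ∃ C : ℝ, ∀ t : ℝ, |deriv F t| ≤ C)
    (u v : DGCalculus.E d → ℝ)
    (hu : T.MemVh u) (huΩ : ContinuousOn u Ω)
    (hv : T.MemVh v) (hvΩ : ContinuousOn v Ω) :
    -- the discrete derivatives of `uv` and of `F(u)` are well defined
    (T.MemVh (fun x => u x * v x) ∧ T.MemVh (fun x => F (u x)) ∧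
      ∀ (s : DGCalculus.Side) (i : Fin d),
        (∃! p, T.IsDiscretePartialSided r γ s i (fun x => u x * v x) p) ∧
        (∃! p, T.IsDiscretePartialSided r γ s i (fun x => F (u x)) p)) ∧
    -- for every version of the weak derivatives the projections are well defined and the
    -- product rule and the chain rule hold
    (∀ (i : Fin d) (du dv : DGCalculus.E d → ℝ), T.IsPartial i u du → T.IsPartial i v dv →
      IntegrableOn (fun x => u x * dv x + v x * du x) (⋃ j, T.cell j) volume ∧
      (∃! p, T.IsL2Projection r (fun x => u x * dv x + v x * du x) p) ∧
      T.discretePartial r γ i (fun x => u x * v x) =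
        T.L2Projection r (fun x => u x * dv x + v x * du x)) ∧
    (∀ (i : Fin d) (du : DGCalculus.E d → ℝ), T.IsPartial i u du →
      IntegrableOn (fun x => deriv F (u x) * du x) (⋃ j, T.cell j) volume ∧
      (∃! p, T.IsL2Projection r (fun x => deriv F (u x) * du x) p) ∧
      T.discretePartial r γ i (fun x => F (u x)) =
        T.L2Projection r (fun x => deriv F (u x) * du x)) := by
  have huv := hu.mul hv
  have hFu := hu.comp hF
  have huvΩ : ContinuousOn (fun x => u x * v x) Ω := huΩ.mul hvΩ
  have hFuΩ : ContinuousOn (fun x => F (u x)) Ω := hF.continuous.comp_continuousOn huΩ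
  refine ⟨⟨huv, hFu, fun s i => ⟨?_, ?_⟩⟩, fun i du dv hdu hdv => ?_, fun i du hdu => ?_⟩
  · exact DGCalculus.Mesh.existsUnique_isDiscretePartialSided hΩ γ s i huv huvΩ
  · exact DGCalculus.Mesh.existsUnique_isDiscretePartialSided hΩ γ s i hFu hFuΩ
  · have hP := DGCalculus.Mesh.IsPartial.mul hu hv hdu hdv
    exact ⟨hP.integrableOn_iUnion, T.existsUnique_isL2Projection r fun j => (hP j).1,
      DGCalculus.Mesh.discretePartial_eq_L2Projection hΩ γ i huv huvΩ hP⟩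
  · have hP := DGCalculus.Mesh.IsPartial.comp hu hdu hF
    exact ⟨hP.integrableOn_iUnion, T.existsUnique_isL2Projection r fun j => (hP j).1,
      DGCalculus.Mesh.discretePartial_eq_L2Projection hΩ γ i hFu hFuΩ hP⟩
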